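/- Let $d\ge 1$ be an integer and $1\le p<\infty$. There is a real number $q>p$, depending only on $p$ and $d$, such that the following holds. Let $\Omega\subset\mathbb R^d$ be open, bounded, connected and polyhedral (that is, $\partial\Omega=\overline\Omega\setminus\Omega$ is a finite union of subsets of hyperplanes), and let $\eta>0$. Then there is a constant $C>0$, depending only on $d$, $\Omega$, $p$ and $\eta$, such that for every discretisation $\mathcal D=(\mathcal M,\mathcal E,\mathcal P)$ of $\Omega$ (as defined below) satisfying $$\eta\le \frac{d_{K,\sigma}}{d_{L,\sigma}}\le\frac1\eta\qquad\text{for all }\sigma\in\mathcal E\text{ with }\mathcal M_\sigma=\{K,L\},\ K\neq L,$$ and every function $u:\Omega\to\mathbb R$ that is (almost everywhere) equal to a constant $u_K$ on each $K\in\mathcal M$, $$\|u\|_{L^q(\Omega)}\le C\,\|u\|_{1,p,\mathcal M},\qquad \|u\|_{1,p,\mathcal M}^p=\sum_{K\in\mathcal M}\sum_{\sigma\in\mathcal E_K}|\sigma|\,d_{K,\sigma}\Big(\frac{D_\sigma u}{d_\sigma}\Big)^p .$$ Here $D_\sigma u=|u_K-u_L|$ and $d_\sigma=d_{K,\sigma}+d_{L,\sigma}$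 if $\mathcal M_\sigma=\{K,L\}$ with $K\ne L$, while $D_\sigma u=|u_K|$ and $d_\sigma=d_{K,\sigma}$ if $\mathcal M_\sigma=\{K\}$. A discretisation of $\Omega$ is a triple $(\mathcal M,\mathcal E,\mathcal P)$ as follows. (1) $\mathcal M$ is a finite family of nonempty connected open pairwise disjoint subsets of $\Omega$ (control volumes) with $\overline\Omega=\bigcup_{K\in\mathcal M}\overline K$; write $\partial K=\overline K\setminus K$. (2) $\mathcal E$ is a finite family of pairwise disjoint subsets of $\overline\Omega$ (edges); each $\sigma\in\mathcal E$ is a nonempty open subset of a hyperplane of $\mathbb R^d$, its $(d-1)$-dimensional measure $|\sigma|$ is positive, and its relative boundary $\overline\sigma\setminus\sigma$ has $(d-1)$-dimensional measure $0$. For each $K\in\mathcal M$ there is a subset $\mathcal E_K\subset\mathcal E$ with $\partial K=\bigcup_{\sigma\in\mathcal E_K}\overline\sigma$. For each $\sigma\in\mathcal E$, the set $\mathcal M_\sigma=\{K\in\mathcal M:\sigma\in\mathcal E_K\}$ either has exactly one element, and then $\sigma\subset\partial\Omega$, or has exactly two elements. (3) $\mathcal P=(x_K)_{K\in\mathcal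 M}$ is a family of points with $x_K\in K$ such that $K$ is star-shaped with respect to $x_K$, and for all $K\in\mathcal M$ and $\sigma\in\mathcal E_K$ the distance $d_{K,\sigma}$ from $x_K$ to the hyperplane containing $\sigma$ is positive. -/

import Mathlib

open MeasureTheory

noncomputable section

/-- A set is covered by finitely many hyperplanes of `ℝ^d`, i.e. it is a finite union of subsets of
hyperplanes. -/
def CoveredByHyperplanes {d : ℕ} (s : Set (EuclideanSpace ℝ (Fin d))) : Prop :=
  ∃ A : Finset (AffineSubspace ℝ (EuclideanSpace ℝ (Fin d))),
    (∀ H ∈ A, (H : Set (EuclideanSpace ℝ (Fin d))).Nonempty ∧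
      Module.finrank ℝ H.direction + 1 = d) ∧
    s ⊆ ⋃ H ∈ A, (H : Set (EuclideanSpace ℝ (Fin d)))

/-- A polyhedral open bounded connected subset of `ℝ^d`; the boundary of an open set `Ω` is
`closure Ω \ Ω`. -/
structure IsPolyhedralDomain {d : ℕ} (Ω : Set (EuclideanSpace ℝ (Fin d))) : Prop where
  isOpen : IsOpen Ω
  isBounded : Bornology.IsBounded Ω
  isConnected : IsConnected Ω
  polyhedral : CoveredByHyperplanes (closure Ω \ Ω)

/-- A space discretisation of `Ω`: control volumes, edges and cell points.
The hyperplane containing an edge `σ` is its affine span, and the `(d-1)`-dimensional measure of `σ`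
is `μHE[d - 1] σ` (Hausdorff measure normalised so as to agree with Lebesgue measure on
hyperplanes). -/
structure SpaceDiscretisation {d : ℕ} (Ω : Set (EuclideanSpace ℝ (Fin d))) where
  /-- the control volumes -/
  cells : Finset (Set (EuclideanSpace ℝ (Fin d)))
  cell_subset : ∀ K ∈ cells, K ⊆ Ω
  cell_isOpen : ∀ K ∈ cells, IsOpen K
  /-- nonempty and connected -/
  cell_isConnected : ∀ K ∈ cells, IsConnected K
  cells_disjoint : ∀ K ∈ cells, ∀ L ∈ cells, K ≠ L → Disjoint K L
  closure_eq : closure Ω = ⋃ K ∈ cells, closure K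
  /-- the edges -/
  edges : Finset (Set (EuclideanSpace ℝ (Fin d)))
  edge_subset : ∀ σ ∈ edges, σ ⊆ closure Ω
  edges_disjoint : ∀ σ ∈ edges, ∀ τ ∈ edges, σ ≠ τ → Disjoint σ τ
  edge_nonempty : ∀ σ ∈ edges, σ.Nonempty
  /-- the affine span of an edge is a hyperplane … -/
  edge_hyperplane : ∀ σ ∈ edges, Module.finrank ℝ (affineSpan ℝ σ).direction + 1 = d
  /-- … in which the edge is open -/
  edge_isOpen : ∀ σ ∈ edges, ∃ U : Set (EuclideanSpace ℝ (Fin d)), IsOpen U ∧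
    σ = U ∩ (affineSpan ℝ σ : Set (EuclideanSpace ℝ (Fin d)))
  edge_measure_pos : ∀ σ ∈ edges, 0 < μHE[d - 1] σ
  /-- the boundary of an edge inside its hyperplane is negligible (as for every polyhedral edge) -/
  edge_boundary_null : ∀ σ ∈ edges, μHE[d - 1] (closure σ \ σ) = 0
  /-- the set of edges of a control volume -/
  edgesOf : Set (EuclideanSpace ℝ (Fin d)) → Finset (Set (EuclideanSpace ℝ (Fin d)))
  edgesOf_subset : ∀ K ∈ cells, edgesOf K ⊆ edges
  cell_boundary : ∀ K ∈ cells, closure K \ K = ⋃ σ ∈ edgesOf K, closure σ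
  /-- every edge is a boundary interface or an interior interface -/
  edge_cells : ∀ σ ∈ edges,
    ({K | K ∈ cells ∧ σ ∈ edgesOf K}.ncard = 1 ∧ σ ⊆ closure Ω \ Ω) ∨
      {K | K ∈ cells ∧ σ ∈ edgesOf K}.ncard = 2
  /-- the point `x_K` of a control volume -/
  center : Set (EuclideanSpace ℝ (Fin d)) → EuclideanSpace ℝ (Fin d)
  center_mem : ∀ K ∈ cells, center K ∈ K
  cell_starConvex : ∀ K ∈ cells, StarConvex ℝ (center K) K
  center_dist_pos : ∀ K ∈ cells, ∀ σ ∈ edgesOf K,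
    0 < Metric.infDist (center K) (affineSpan ℝ σ : Set (EuclideanSpace ℝ (Fin d)))

namespace SpaceDiscretisation

variable {d : ℕ} {Ω : Set (EuclideanSpace ℝ (Fin d))}

open Classical in
/-- `M_σ`: the control volumes that have `σ` as an edge. -/
def cellsOf (D : SpaceDiscretisation Ω) (σ : Set (EuclideanSpace ℝ (Fin d))) :
    Finset (Set (EuclideanSpace ℝ (Fin d))) :=
  D.cells.filter (fun K => σ ∈ D.edgesOf K)

/-- `d_{K,σ}`: the Euclidean distance from `x_K` to the hyperplane containing `σ`. -/
def cellDist (D : SpaceDiscretisation Ω) (K σ : Set (EuclideanSpace ℝ (Fin d))) : ℝ :=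
  Metric.infDist (D.center K) (affineSpan ℝ σ : Set (EuclideanSpace ℝ (Fin d)))

/-- `d_σ`, which is `d_{K,σ} + d_{L,σ}` if `M_σ = {K, L}` and `d_{K,σ}` if `M_σ = {K}`. -/
def edgeDist (D : SpaceDiscretisation Ω) (σ : Set (EuclideanSpace ℝ (Fin d))) : ℝ :=
  ∑ K ∈ D.cellsOf σ, D.cellDist K σ

open Classical in
/-- `D_σ v` for cell values `v`, seen from a control volume `K ∈ M_σ`: it is `|v_K - v_L|` if
`M_σ = {K, L}` and `|v_K|` if `M_σ = {K}`. -/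
def jump (D : SpaceDiscretisation Ω) (v : Set (EuclideanSpace ℝ (Fin d)) → ℝ)
    (K σ : Set (EuclideanSpace ℝ (Fin d))) : ℝ :=
  |v K - ∑ L ∈ (D.cellsOf σ).erase K, v L|

/-- The discrete `W^{1,p}` norm of the piecewise constant function with cell values `v`. -/
def discreteNorm (D : SpaceDiscretisation Ω) (p : ℝ)
    (v : Set (EuclideanSpace ℝ (Fin d)) → ℝ) : ℝ :=
  (∑ K ∈ D.cells, ∑ σ ∈ D.edgesOf K,
    (μHE[d - 1] σ).toReal * D.cellDist K σ * (D.jump v K σ / D.edgeDist σ) ^ p) ^ (1 / p)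

/-- `u` is the piecewise constant function whose value on each control volume `K` is `v K`
(almost everywhere). Only the values of `v` on control volumes matter. -/
def HasCellValues (D : SpaceDiscretisation Ω) (u : EuclideanSpace ℝ (Fin d) → ℝ)
    (v : Set (EuclideanSpace ℝ (Fin d)) → ℝ) : Prop :=
  ∀ K ∈ D.cells, ∀ᵐ x ∂(volume.restrict K), u x = v K

/-- The mesh ratio bound `η ≤ d_{K,σ} / d_{L,σ} ≤ 1 / η` on every interior interface. -/
def RatioBound (D : SpaceDiscretisation Ω) (η : ℝ) : Prop :=
  ∀ σ ∈ D.edges, ∀ K ∈ D.cellsOf σ, ∀ L ∈ D.cellsOf σ, K ≠ L →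
    η ≤ D.cellDist K σ / D.cellDist L σ ∧ D.cellDist K σ / D.cellDist L σ ≤ 1 / η

end SpaceDiscretisation

end

/-! The function `w = |u|^p`, extended by zero to the whole space, behaves like a function of
bounded variation whose total variation is controlled by `T`, the sum of `|σ|` times the jumps of
`w` across the edges. Boundary edges count too, because of the extension by zero.

A segment from `x` to `x + h` in general position crosses finitely many edges, one at a time, and
the points `x` whose segment meets `σ` have volume at most `‖h‖ |σ|`. Hence `‖w(· + h) - w‖_{L¹} ≤
‖h‖ T` (`lintegral_abs_cellFun_sub_le`). This estimate alone yields everything needed from Sobolev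
theory. A shift by the diameter of a ball containing `Ω` gives a Poincaré inequality `‖w‖_{L¹} ≤
2RT`. Averaging over small shifts gives the weak-type bound `|{w > t}| ≤ C (T/t)^{1 + 1/d}`. The
layer-cake formula then bounds `w` in `L^r` with `r = 1 + 1/(2d)` by a multiple of `T`, so that `q =
p r` works.

It remains to bound `T` by `N^p`, where `N` is the discrete norm. Let `X = ‖w‖_{L¹}`. The inequality
`|a^p - b^p| ≤ p (a^{p-1} + b^{p-1}) |a - b|` for `a, b ≥ 0`, Hölder's inequality with the weights
`|σ| d_{K,σ}`, and the comparison of the sum of these weights over `K` with `|K|` (disjoint cones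
inside the star-shaped cell) give `T ≤ M X^{1 - 1/p} N` (`sum_jump_abs_rpow_le`). With `X ≤ 2RT`
this yields `X^{1/p} ≤ 2RM N`, and therefore `T ≤ C N^p`. -/

/-! ### Hyperplanes, swept volumes and cones -/

section Hyperplanes

variable {d : ℕ}

lemma exists_unit_normal (H : AffineSubspace ℝ (EuclideanSpace ℝ (Fin d)))
    (hne : (H : Set (EuclideanSpace ℝ (Fin d))).Nonempty)
    (hH : Module.finrank ℝ H.direction + 1 = d) :
    ∃ (ν : EuclideanSpace ℝ (Fin d)) (c : ℝ), ‖ν‖ = 1 ∧ ∀ x, x ∈ H ↔ inner ℝ ν x = c := by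
  obtain ⟨p, hp⟩ := hne
  have h1 : Module.finrank ℝ H.directionᗮ = 1 := by
    have := H.direction.finrank_add_finrank_orthogonal
    rw [finrank_euclideanSpace_fin] at this
    omega
  obtain ⟨v, hv0, hv⟩ := finrank_eq_one_iff'.1 h1
  have hv0' : (v : EuclideanSpace ℝ (Fin d)) ≠ 0 := by simpa using hv0
  have hn : ‖(v : EuclideanSpace ℝ (Fin d))‖ ≠ 0 := norm_ne_zero_iff.2 hv0'
  refine ⟨‖(v : EuclideanSpace ℝ (Fin d))‖⁻¹ • v,
    inner ℝ (‖(v : EuclideanSpace ℝ (Fin d))‖⁻¹ • (v : EuclideanSpace ℝ (Fin d))) p, ?_, ?_⟩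
  · rw [norm_smul, norm_inv, norm_norm, inv_mul_cancel₀ hn]
  · intro x
    rw [← sub_eq_zero, ← inner_sub_right, inner_smul_left]
    have : x ∈ H ↔ x - p ∈ H.direction := by
      rw [← vsub_eq_sub, AffineSubspace.vsub_right_mem_direction_iff_mem hp]
    rw [this]
    simp only [map_inv₀, conj_trivial, mul_eq_zero, inv_eq_zero, hn, false_or]
    constructor
    · intro hx
      rw [real_inner_comm]
      exact (Submodule.mem_orthogonal _ _).1 v.2 _ hx
    · intro hx
      rw [← Submodule.orthogonal_orthogonal H.direction, Submodule.mem_orthogonal]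
      intro u hu
      obtain ⟨a, ha⟩ := hv ⟨u, hu⟩
      have : u = a • (v : EuclideanSpace ℝ (Fin d)) := by
        rw [← Submodule.coe_smul, ha]
      rw [this, inner_smul_left, hx, mul_zero]

lemma volume_hyperplane_eq_zero {a : EuclideanSpace ℝ (Fin d)} (ha : a ≠ 0) (c : ℝ) :
    volume {x : EuclideanSpace ℝ (Fin d) | inner ℝ a x = c} = 0 := by
  have hna : ‖a‖ ^ 2 ≠ 0 := by simpa using ha
  let p : EuclideanSpace ℝ (Fin d) := (c / ‖a‖ ^ 2) • a
  have hp : inner ℝ a p = c := by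
    simp only [p]
    rw [inner_smul_right, real_inner_self_eq_norm_sq]
    field_simp
  have : {x : EuclideanSpace ℝ (Fin d) | inner ℝ a x = c} =
      (AffineSubspace.mk' p (ℝ ∙ a)ᗮ : Set (EuclideanSpace ℝ (Fin d))) := by
    ext x
    simp only [Set.mem_ofPred_eq, SetLike.mem_coe, AffineSubspace.mem_mk',
      Submodule.mem_orthogonal_singleton_iff_inner_right, vsub_eq_sub, inner_sub_right, hp,
      sub_eq_zero]
  rw [this]
  apply Measure.addHaar_affineSubspace
  intro h
  have h2 : p + a ∈ AffineSubspace.mk' p (ℝ ∙ a)ᗮ := by rw [h]; trivial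
  rw [AffineSubspace.mem_mk', Submodule.mem_orthogonal_singleton_iff_inner_right] at h2
  simp at h2
  exact ha h2

/-- Slicing of the Lebesgue measure by the hyperplanes orthogonal to a unit vector. -/
lemma volume_eq_lintegral_slices {ν : EuclideanSpace ℝ (Fin d)} (hν : ‖ν‖ = 1) (c : ℝ)
    {A : Set (EuclideanSpace ℝ (Fin d))} (hA : MeasurableSet A) :
    volume A = ∫⁻ t : ℝ, μHE[d - 1] (A ∩ {x | inner ℝ ν x = c + t}) := by
  have hν0 : ν ≠ 0 := by
    intro h; simp [h] at hν
  have h := EuclideanGeometry.euclideanHausdorffMeasure_eq_lintegral (c • ν) hν0 hA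
  have h1 : ‖ν‖ₑ = 1 := by rw [← ofReal_norm, hν]; simp
  rw [finrank_euclideanSpace_fin, EuclideanSpace.euclideanHausdorffMeasure_eq_volume, h1,
    one_mul] at h
  rw [h]
  congr 1
  ext t
  congr 2
  ext x
  simp only [SetLike.mem_coe, AffineSubspace.mem_mk',
      Submodule.mem_orthogonal_singleton_iff_inner_right, vsub_eq_sub, inner_sub_right,
      sub_eq_zero, Set.mem_ofPred_eq, vadd_eq_add, inner_add_right, inner_smul_right,
      real_inner_self_eq_norm_sq, hν]
  constructor <;> intro h <;> linarith

/-- Slice by the hyperplanes parallel to the one containing `N`. A point at signed distance `t` from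
it can reach `N` only at time `s = -t / ⟪ν, h⟫`, so each slice lies in a translate of `N`, and is
empty unless that time is in `I`. Integrating in `t` gives the factor `|⟪ν, h⟫| ≤ ‖h‖`. -/
lemma volume_sweep_le {ν : EuclideanSpace ℝ (Fin d)} (hν : ‖ν‖ = 1) {c : ℝ}
    {N : Set (EuclideanSpace ℝ (Fin d))} (hN : MeasurableSet N)
    (hNH : ∀ x ∈ N, inner ℝ ν x = c) {I : Set ℝ} (hI : MeasurableSet I)
    (h : EuclideanSpace ℝ (Fin d)) :
    volume {x | ∃ s ∈ I, x + s • h ∈ N} ≤ volume I * ENNReal.ofReal ‖h‖ * μHE[d - 1] N := by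
  have hν0 : ν ≠ 0 := by
    intro h; simp [h] at hν
  set b : ℝ := inner ℝ ν h with hb
  -- If `h` is parallel to the hyperplane, the swept set stays inside it and is null.
  by_cases hb0 : b = 0
  · refine le_trans (le_of_eq ?_) zero_le
    refine measure_mono_null ?_ (volume_hyperplane_eq_zero hν0 c)
    rintro x ⟨s, -, hs⟩
    have := hNH _ hs
    rw [inner_add_right, inner_smul_right, ← hb, hb0] at this
    simpa using this
  · have hset : {x | ∃ s ∈ I, x + s • h ∈ N} =
        {x | (c - inner ℝ ν x) / b ∈ I ∧ x + ((c - inner ℝ ν x) / b) • h ∈ N} := by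
      ext x
      constructor
      · rintro ⟨s, hs, hx⟩
        have := hNH _ hx
        rw [inner_add_right, inner_smul_right, ← hb] at this
        have hs' : s = (c - inner ℝ ν x) / b := by
          field_simp; linarith
        exact ⟨hs' ▸ hs, hs' ▸ hx⟩
      · rintro ⟨h1, h2⟩
        exact ⟨_, h1, h2⟩
    have hm1 : Measurable fun x : EuclideanSpace ℝ (Fin d) => (c - inner ℝ ν x) / b := by
      fun_prop
    have hm2 : Measurable fun x : EuclideanSpace ℝ (Fin d) =>
        x + ((c - inner ℝ ν x) / b) • h := by fun_prop
    have hmeas : MeasurableSet {x : EuclideanSpace ℝ (Fin d) | (c - inner ℝ ν x) / b ∈ I ∧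
        x + ((c - inner ℝ ν x) / b) • h ∈ N} := (hm1 hI).inter (hm2 hN)
    rw [hset, volume_eq_lintegral_slices hν c hmeas]
    have hle : ∀ t : ℝ, μHE[d - 1] ({x | (c - inner ℝ ν x) / b ∈ I ∧
        x + ((c - inner ℝ ν x) / b) • h ∈ N} ∩ {x | inner ℝ ν x = c + t}) ≤
        ((fun t : ℝ => (-b⁻¹) * t) ⁻¹' I).indicator (fun _ => μHE[d - 1] N) t := by
      intro t
      by_cases ht : (-b⁻¹) * t ∈ I
      · rw [Set.indicator_of_mem (by exact ht),
          ← measure_preimage_add_right μHE[d - 1] (((-b⁻¹) * t) • h) N]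
        apply measure_mono
        rintro x ⟨⟨-, h2⟩, h3⟩
        have h3' : inner ℝ ν x = c + t := h3
        have : (c - inner ℝ ν x) / b = (-b⁻¹) * t := by rw [h3']; field_simp; ring
        rw [this] at h2
        exact h2
      · rw [Set.indicator_of_notMem (by exact ht)]
        refine le_of_eq ?_
        convert measure_empty (μ := (μHE[d - 1] : Measure (EuclideanSpace ℝ (Fin d))))
        ext x
        simp only [Set.mem_inter_iff, Set.mem_ofPred_eq, Set.mem_empty_iff_false, iff_false]
        rintro ⟨⟨h1, -⟩, h3⟩
        have : (c - inner ℝ ν x) / b = (-b⁻¹) * t := by rw [h3]; field_simp; ring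
        exact ht (this ▸ h1)
    refine (lintegral_mono hle).trans ?_
    rw [lintegral_indicator_const (hI.preimage (by fun_prop)),
      Real.volume_preimage_mul_left (by simpa using hb0), mul_comm]
    rw [mul_comm (volume I)]
    gcongr
    rw [inv_neg, inv_inv, abs_neg]
    calc |b| ≤ ‖ν‖ * ‖h‖ := abs_real_inner_le_norm _ _
      _ = ‖h‖ := by rw [hν, one_mul]

/-- The open cone with apex `x` over the set `N` contained in the hyperplane
`⟪ν, ·⟫ = c`. -/
noncomputable def coneOver (ν : EuclideanSpace ℝ (Fin d)) (c : ℝ) (x : EuclideanSpace ℝ (Fin d))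
    (N : Set (EuclideanSpace ℝ (Fin d))) : Set (EuclideanSpace ℝ (Fin d)) :=
  {z | inner ℝ ν (z - x) / (c - inner ℝ ν x) ∈ Set.Ioo (0 : ℝ) 1 ∧
    x + (inner ℝ ν (z - x) / (c - inner ℝ ν x))⁻¹ • (z - x) ∈ N}

lemma measurableSet_coneOver {ν : EuclideanSpace ℝ (Fin d)} {c : ℝ}
    {x : EuclideanSpace ℝ (Fin d)} {N : Set (EuclideanSpace ℝ (Fin d))} (hN : MeasurableSet N) :
    MeasurableSet (coneOver ν c x N) := by
  have hm1 : Measurable fun z : EuclideanSpace ℝ (Fin d) =>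
      inner ℝ ν (z - x) / (c - inner ℝ ν x) := by fun_prop
  have hm2 : Measurable fun z : EuclideanSpace ℝ (Fin d) =>
      x + (inner ℝ ν (z - x) / (c - inner ℝ ν x))⁻¹ • (z - x) :=
    measurable_const.add (hm1.inv.smul (by fun_prop))
  exact (hm1 measurableSet_Ioo).inter (hm2 hN)

lemma exists_of_mem_coneOver {ν : EuclideanSpace ℝ (Fin d)} {c : ℝ}
    {x z : EuclideanSpace ℝ (Fin d)} {N : Set (EuclideanSpace ℝ (Fin d))}
    (hz : z ∈ coneOver ν c x N) :
    ∃ y ∈ N, ∃ r ∈ Set.Ioo (0 : ℝ) 1, z = x + r • (y - x) := by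
  refine ⟨_, hz.2, _, hz.1, ?_⟩
  have := hz.1.1.ne'
  rw [add_sub_cancel_left, smul_smul, mul_inv_cancel₀ this]
  simp

/-- Only the outer half of the cone is used. Its slices are homothetic images of `N` with ratio at
least `1/2`, hence of measure at least `2^{-(d-1)}` times that of `N`, over a range of heights of
length half the total. This crude count explains `2^d` in place of the exact constant `d`. -/
lemma mul_le_volume_coneOver (hd : 1 ≤ d) {ν : EuclideanSpace ℝ (Fin d)} (hν : ‖ν‖ = 1) {c : ℝ}
    {N : Set (EuclideanSpace ℝ (Fin d))} (hN : MeasurableSet N)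
    (hNH : ∀ x ∈ N, inner ℝ ν x = c) {x : EuclideanSpace ℝ (Fin d)}
    (hx : inner ℝ ν x ≠ c) :
    ENNReal.ofReal |c - inner ℝ ν x| * μHE[d - 1] N ≤ 2 ^ d * volume (coneOver ν c x N) := by
  set δ : ℝ := c - inner ℝ ν x with hδ
  have hδ0 : δ ≠ 0 := sub_ne_zero.2 (Ne.symm hx)
  rw [volume_eq_lintegral_slices hν (inner ℝ ν x) (measurableSet_coneOver hN)]
  have hle : ∀ t : ℝ, ((fun t : ℝ => δ⁻¹ * t) ⁻¹' (Set.Ioo (1 / 2) 1)).indicator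
      (fun _ => (2⁻¹ : ENNReal) ^ (d - 1) * μHE[d - 1] N) t ≤
      μHE[d - 1] (coneOver ν c x N ∩ {z | inner ℝ ν z = inner ℝ ν x + t}) := by
    intro t
    by_cases ht : δ⁻¹ * t ∈ Set.Ioo (1 / 2 : ℝ) 1
    · rw [Set.indicator_of_mem (by exact ht)]
      have h0 : δ⁻¹ * t ≠ 0 := by have := ht.1; linarith
      have h1 := euclideanHausdorffMeasure_homothety_image (d - 1) x h0 N
      calc (2⁻¹ : ENNReal) ^ (d - 1) * μHE[d - 1] N
          ≤ (‖δ⁻¹ * t‖₊ : ENNReal) ^ (d - 1) * μHE[d - 1] N := by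
            gcongr
            have h3 : (2⁻¹ : NNReal) ≤ ‖δ⁻¹ * t‖₊ := by
              rw [← NNReal.coe_le_coe, coe_nnnorm, Real.norm_eq_abs, abs_of_pos (by linarith [ht.1])]
              push_cast; linarith [ht.1]
            have := ENNReal.coe_le_coe.2 h3
            simpa using this
        _ = μHE[d - 1] (AffineMap.homothety x (δ⁻¹ * t) '' N) := by
            rw [h1, ENNReal.smul_def, smul_eq_mul]; push_cast; rfl
        _ ≤ _ := by
            apply measure_mono
            rintro _ ⟨y, hy, rfl⟩
            have hy' := hNH y hy
            have e1 : AffineMap.homothety x (δ⁻¹ * t) y - x = (δ⁻¹ * t) • (y - x) := by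
              simp [AffineMap.homothety_apply]
            have e2 : inner ℝ ν (AffineMap.homothety x (δ⁻¹ * t) y - x) = t := by
              rw [e1, inner_smul_right, inner_sub_right, hy', ← hδ]; field_simp
            refine ⟨⟨?_, ?_⟩, ?_⟩
            · rw [e2, ← hδ, div_eq_inv_mul]; exact ⟨by linarith [ht.1], ht.2⟩
            · rw [e2, ← hδ, div_eq_inv_mul, e1, smul_smul, inv_mul_cancel₀ h0]
              simpa using hy
            · rw [inner_sub_right] at e2
              simp only [Set.mem_ofPred_eq]; linarith
    · rw [Set.indicator_of_notMem (by exact ht)]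
      exact zero_le
  have := lintegral_mono (μ := volume) hle
  rw [lintegral_indicator_const (measurableSet_Ioo.preimage (by fun_prop)),
      Real.volume_preimage_mul_left (by simpa using hδ0), inv_inv, Real.volume_Ioo] at this
  refine le_trans (le_of_eq ?_) (mul_le_mul_right this _)
  obtain ⟨n, rfl⟩ : ∃ n, d = n + 1 := ⟨d - 1, by omega⟩
  have e3 : ENNReal.ofReal (1 - 1 / 2) = 2⁻¹ := by
    rw [show (1 - 1 / 2 : ℝ) = 2⁻¹ by norm_num, ENNReal.ofReal_inv_of_pos (by norm_num)]; simp
  rw [e3, Nat.add_sub_cancel]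
  have e4 : (2 : ENNReal) ^ (n + 1) * (2⁻¹ ^ n * 2⁻¹) = 1 := by
    rw [← pow_succ, ← mul_pow, ENNReal.mul_inv_cancel (by norm_num) (by norm_num), one_pow]
  calc ENNReal.ofReal |δ| * μHE[n] N = (2 ^ (n + 1) * (2⁻¹ ^ n * 2⁻¹)) *
        (ENNReal.ofReal |δ| * μHE[n] N) := by rw [e4, one_mul]
    _ = _ := by ring

end Hyperplanes

/-! ### Piecewise constant functions of one variable -/

section OneDimensional

open Filter Topology

lemma eq_of_locally_constant_on_Icc {g : ℝ → ℝ} {a b : ℝ} (hab : a ≤ b)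
    (hg : ∀ s ∈ Set.Icc a b, ∀ᶠ s' in 𝓝 s, g s' = g s) : g b = g a := by
  refine constant_of_has_deriv_right_zero (a := a) (b := b) ?_ ?_ b (Set.right_mem_Icc.2 hab)
  · intro s hs
    have h : g =ᶠ[𝓝 s] fun _ => g s := hg s hs
    exact (continuousAt_const.congr h.symm).continuousWithinAt
  · intro s hs
    have h : g =ᶠ[𝓝 s] fun _ => g s := hg s ⟨hs.1, hs.2.le⟩
    exact ((hasDerivAt_const s (g s)).congr_of_eventuallyEq h).hasDerivWithinAt

/-- A function of one variable that is locally constant away from finitely many times `t i`, with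
oscillation at most `j i` across `t i`, varies by at most the sum of the `j i`. -/
lemma abs_sub_le_sum_of_finite_jumps {ι : Type*} [DecidableEq ι] {g : ℝ → ℝ} {t j : ι → ℝ}
    (hj : ∀ i, 0 ≤ j i) (F : Finset ι) : ∀ a b : ℝ, a ≤ b →
    (∀ i ∈ F, t i ≠ a ∧ t i ≠ b) →
    (∀ s ∈ Set.Icc a b, (∀ i ∈ F, t i ≠ s) → ∀ᶠ s' in 𝓝 s, g s' = g s) →
    (∀ i ∈ F, t i ∈ Set.Icc a b → ∃ ε > 0, ∀ s s' : ℝ, s ≠ t i → s' ≠ t i → |s - t i| < ε →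
      |s' - t i| < ε → |g s - g s'| ≤ j i) →
    |g b - g a| ≤ ∑ i ∈ F, j i := by
  -- Induction peels off the index with the latest jump time; several indices may share a time.
  induction F using Finset.induction_on_max_value t with
  | empty =>
    intro a b hab _ h2 _
    rw [eq_of_locally_constant_on_Icc hab (fun s hs => h2 s hs (by simp))]
    simp
  | insert k s hk hmax ih =>
    intro a b hab h1 h2 h3
    rw [Finset.sum_insert hk]
    -- If `t k` is in the interval and not shared, choose `x < t k < y` close to it: induction
    -- handles `[a, x]`, the oscillation bound handles `x` to `y`, and nothing jumps on `[y, b]`.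
    by_cases hin : t k ∈ Set.Icc a b ∧ ∀ i ∈ s, t i ≠ t k
    · obtain ⟨hin, hne⟩ := hin
      obtain ⟨ε, hε, hosc⟩ := h3 k (Finset.mem_insert_self _ _) hin
      have hka := h1 k (Finset.mem_insert_self _ _)
      have hak : a < t k := lt_of_le_of_ne hin.1 hka.1.symm
      have hkb : t k < b := lt_of_le_of_ne hin.2 hka.2
      have hlt : ∀ i ∈ s, t i < t k := fun i hi => lt_of_le_of_ne (hmax i hi) (hne i hi)
      have hev : ∀ᶠ x in 𝓝[<] t k, x ∈ Set.Ioo (max a (t k - ε)) (t k) ∧ ∀ i ∈ s, t i < x := by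
        have hlow : max a (t k - ε) < t k := by rw [max_lt_iff]; constructor <;> linarith
        have hall : ∀ᶠ x in 𝓝[<] t k, ∀ i ∈ s, t i < x := by
          rw [eventually_all_finset]
          intro i hi
          filter_upwards [Ioo_mem_nhdsLT (hlt i hi)] with x hx using hx.1
        filter_upwards [Ioo_mem_nhdsLT hlow, hall] with x hx hx' using ⟨hx, hx'⟩
      obtain ⟨x, ⟨hx1, hx2⟩, hx3⟩ := hev.exists
      rw [max_lt_iff] at hx1
      obtain ⟨y, hy1, hy2⟩ := exists_between (show t k < min b (t k + ε) by
        rw [lt_min_iff]; constructor <;> linarith)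
      rw [lt_min_iff] at hy2
      have e1 : |g x - g a| ≤ ∑ i ∈ s, j i := by
        refine ih a x hx1.1.le (fun i hi => ⟨(h1 i (Finset.mem_insert_of_mem hi)).1,
          (hx3 i hi).ne⟩) ?_ ?_
        · intro r hr hi
          refine h2 r ⟨hr.1, by linarith [hr.2]⟩ ?_
          intro i hi'
          rcases Finset.mem_insert.1 hi' with rfl | hi'
          · linarith [hr.2]
          · exact hi i hi'
        · intro i hi hir
          exact h3 i (Finset.mem_insert_of_mem hi) ⟨hir.1, by linarith [hir.2]⟩
      have e2 : |g y - g x| ≤ j k := by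
        apply hosc y x hy1.ne' hx2.ne <;> rw [abs_lt] <;> constructor <;> linarith
      have e3 : g b = g y := by
        refine eq_of_locally_constant_on_Icc hy2.1.le ?_
        intro r hr
        refine h2 r ⟨by linarith [hr.1], hr.2⟩ ?_
        intro i hi'
        have : t i ≤ t k := by
          rcases Finset.mem_insert.1 hi' with rfl | hi'
          · exact le_rfl
          · exact hmax i hi'
        linarith [hr.1]
      rw [e3]
      calc |g y - g a| ≤ |g y - g x| + |g x - g a| := abs_sub_le _ _ _
        _ ≤ _ := add_le_add e2 e1
    -- Otherwise `k` can be dropped: its time is outside the interval or is also the time of another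
    -- index.
    · have := ih a b hab (fun i hi => h1 i (Finset.mem_insert_of_mem hi)) ?_
        (fun i hi => h3 i (Finset.mem_insert_of_mem hi))
      · linarith [hj k]
      · intro r hr hi
        refine h2 r hr ?_
        intro i hi'
        rcases Finset.mem_insert.1 hi' with rfl | hi'
        · rintro rfl
          exact hin ⟨hr, hi⟩
        · exact hi i hi'

end OneDimensional

/-! ### Inequalities for powers -/

section PowerInequality

/-- The graph of the convex function `t ↦ t^p` lies above its tangent at `x`; for `x > 0` this is
Bernoulli's inequality for `y / x`. -/
lemma rpow_sub_rpow_le {p : ℝ} (hp : 1 ≤ p) {x y : ℝ} (hx : 0 ≤ x) (hy : 0 ≤ y) :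
    x ^ p - y ^ p ≤ p * x ^ (p - 1) * (x - y) := by
  rcases hx.eq_or_lt with rfl | hx
  · rw [Real.zero_rpow (by linarith)]
    rcases hp.eq_or_lt with rfl | hp
    · simp
    · rw [Real.zero_rpow (by linarith)]
      simp [Real.rpow_nonneg hy]
  · have h := one_add_mul_self_le_rpow_one_add (s := (y - x) / x)
      (by rw [le_div_iff₀ hx]; linarith) hp
    have e : 1 + (y - x) / x = y / x := by field_simp; ring
    rw [e, Real.div_rpow hy hx.le, le_div_iff₀ (Real.rpow_pos_of_pos hx p)] at h
    have e2 : x ^ p = x ^ (p - 1) * x := by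
      rw [← Real.rpow_add_one hx.ne']; ring_nf
    have e3 : (1 + p * ((y - x) / x)) * x ^ p = x ^ p + p * x ^ (p - 1) * (y - x) := by
      rw [e2]; field_simp
    linarith

lemma abs_rpow_sub_rpow_le {p : ℝ} (hp : 1 ≤ p) (x y : ℝ) :
    |(|x| ^ p - |y| ^ p)| ≤ p * (|x| ^ (p - 1) * |x - y| + |y| ^ (p - 1) * |x - y|) := by
  have h1 := rpow_sub_rpow_le hp (abs_nonneg x) (abs_nonneg y)
  have h2 := rpow_sub_rpow_le hp (abs_nonneg y) (abs_nonneg x)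
  have h3 : |x| - |y| ≤ |x - y| := abs_sub_abs_le_abs_sub x y
  have h4 : |y| - |x| ≤ |x - y| := by rw [abs_sub_comm x y]; exact abs_sub_abs_le_abs_sub y x
  have hx : 0 ≤ |x| ^ (p - 1) := by positivity
  have hy : 0 ≤ |y| ^ (p - 1) := by positivity
  have h5 : p * |x| ^ (p - 1) * (|x| - |y|) ≤ p * |x| ^ (p - 1) * |x - y| := by gcongr
  have h6 : p * |y| ^ (p - 1) * (|y| - |x|) ≤ p * |y| ^ (p - 1) * |x - y| := by gcongr
  have h7 : 0 ≤ p * |x| ^ (p - 1) * |x - y| := by positivity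
  have h8 : 0 ≤ p * |y| ^ (p - 1) * |x - y| := by positivity
  rw [abs_le]
  constructor <;> nlinarith

/-- Hölder's inequality with weights, including the exponent `1`. -/
lemma sum_weight_rpow_mul_le {ι : Type*} (s : Finset ι) {p : ℝ} (hp : 1 ≤ p) {m a b : ι → ℝ}
    (hm : ∀ i ∈ s, 0 ≤ m i) (ha : ∀ i ∈ s, 0 ≤ a i) (hb : ∀ i ∈ s, 0 ≤ b i) :
    ∑ i ∈ s, m i * a i ^ (p - 1) * b i ≤
      (∑ i ∈ s, m i * a i ^ p) ^ (1 - 1 / p) * (∑ i ∈ s, m i * b i ^ p) ^ (1 / p) := by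
  rcases hp.eq_or_lt with rfl | hp
  -- For `p = 1` the powers `a i ^ 0` and the outer power with exponent `0` are all `1`, so the two
  -- sides agree.
  · simp
  · have hpq : (p / (p - 1)).HolderConjugate p := by
      rw [Real.holderConjugate_comm]
      exact Real.HolderConjugate.conjExponent hp
    have hp1 : 0 < p - 1 := by linarith
    have hp0 : 0 < p := by linarith
    have e : 1 / (p / (p - 1)) = 1 - 1 / p := by field_simp
    have h := Real.inner_le_Lp_mul_Lq_of_nonneg s hpq
      (f := fun i => m i ^ (1 - 1 / p) * a i ^ (p - 1)) (g := fun i => m i ^ (1 / p) * b i)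
      (fun i hi => mul_nonneg (Real.rpow_nonneg (hm i hi) _) (Real.rpow_nonneg (ha i hi) _))
      (fun i hi => mul_nonneg (Real.rpow_nonneg (hm i hi) _) (hb i hi))
    rw [e] at h
    calc ∑ i ∈ s, m i * a i ^ (p - 1) * b i
        = ∑ i ∈ s, m i ^ (1 - 1 / p) * a i ^ (p - 1) * (m i ^ (1 / p) * b i) := by
          refine Finset.sum_congr rfl fun i hi => ?_
          have : m i = m i ^ (1 - 1 / p) * m i ^ (1 / p) := by
            rw [← Real.rpow_add_of_nonneg (hm i hi)]
            · simp
            · rw [sub_nonneg, div_le_one hp0]; linarith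
            · positivity
          nth_rewrite 1 [this]
          ring
      _ ≤ _ := h
      _ = _ := by
          congr 2
          · refine Finset.sum_congr rfl fun i hi => ?_
            rw [Real.mul_rpow (Real.rpow_nonneg (hm i hi) _) (Real.rpow_nonneg (ha i hi) _),
              ← Real.rpow_mul (hm i hi), ← Real.rpow_mul (ha i hi)]
            have e1 : (1 - 1 / p) * (p / (p - 1)) = 1 := by field_simp
            have e2 : (p - 1) * (p / (p - 1)) = p := by field_simp
            rw [e1, e2, Real.rpow_one]
          · refine Finset.sum_congr rfl fun i hi => ?_
            rw [Real.mul_rpow (Real.rpow_nonneg (hm i hi) _) (hb i hi),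
              ← Real.rpow_mul (hm i hi)]
            have e1 : 1 / p * p = 1 := by field_simp
            rw [e1, Real.rpow_one]

end PowerInequality

/-! ### From `L¹` translation estimates to higher integrability -/

section Translations

variable {d : ℕ}

/-- A shift of length `2R` moves the ball of radius `R` off itself, so on that ball `w` is, up to
sign, the difference between its translate and itself. -/
lemma lintegral_le_of_translation_estimate (hd : 1 ≤ d) {w : EuclideanSpace ℝ (Fin d) → ℝ}
    {R T : ℝ} (hR : 0 < R) (hsupp : ∀ x, R ≤ ‖x‖ → w x = 0)
    (hT : ∀ h, ∫⁻ x, ENNReal.ofReal |w (x + h) - w x| ≤ ENNReal.ofReal (‖h‖ * T)) :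
    ∫⁻ x, ENNReal.ofReal (w x) ≤ ENNReal.ofReal (2 * R * T) := by
  let h : EuclideanSpace ℝ (Fin d) := EuclideanSpace.single ⟨0, hd⟩ (2 * R)
  have hh : ‖h‖ = 2 * R := by
    simp only [h, PiLp.norm_single, Real.norm_eq_abs]
    exact abs_of_pos (by linarith)
  rw [← hh]
  refine le_trans (lintegral_mono fun x => ENNReal.ofReal_le_ofReal ?_) (hT h)
  by_cases hx : R ≤ ‖x‖
  · rw [hsupp x hx]; positivity
  · have : R ≤ ‖x + h‖ := by
      have := norm_sub_le (x + h) x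
      rw [add_sub_cancel_left, hh] at this
      linarith
    rw [hsupp _ this, zero_sub, abs_neg]
    exact le_abs_self _

/-- By Chebyshev, `w` exceeds `t/2` only on a set of volume at most `4RT/t`. If `w x > t`, then in a
ball of shifts of volume `8RT/t` at least half of them bring `w` down to `t/2` or less, so the
integral of `|w(x + h) - w x|` over these shifts is at least `2RT`. Integrating over such `x` and
exchanging the integrals compares this with the translation estimate. -/
lemma volume_lt_le_of_translation_estimate (hd : 1 ≤ d) {w : EuclideanSpace ℝ (Fin d) → ℝ}
    (hw : Measurable w) {R T : ℝ} (hR : 0 < R) (hsupp : ∀ x, R ≤ ‖x‖ → w x = 0)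
    (hT0 : 0 < T)
    (hT : ∀ h, ∫⁻ x, ENNReal.ofReal |w (x + h) - w x| ≤ ENNReal.ofReal (‖h‖ * T))
    {t : ℝ} (ht : 0 < t) :
    volume {x | t < w x} ≤ ENNReal.ofReal
      (4 * (8 * R / (volume (Metric.ball (0 : EuclideanSpace ℝ (Fin d)) 1)).toReal) ^ (1 / d : ℝ) *
        (T / t) ^ (1 + 1 / d : ℝ)) := by
  set ω : ℝ := (volume (Metric.ball (0 : EuclideanSpace ℝ (Fin d)) 1)).toReal with hω
  have hωtop : volume (Metric.ball (0 : EuclideanSpace ℝ (Fin d)) 1) ≠ ⊤ :=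
    measure_ball_lt_top.ne
  have hω0 : 0 < ω := ENNReal.toReal_pos (Metric.measure_ball_pos _ _ one_pos).ne' hωtop
  have hd0 : (0 : ℝ) < d := by exact_mod_cast hd
  -- The radius for which the ball has volume `8RT/t`, twice the Chebyshev bound.
  set ρ : ℝ := (8 * R / ω) ^ (1 / d : ℝ) * (T / t) ^ (1 / d : ℝ) with hρ
  have hρ0 : 0 < ρ := by positivity
  have hρd : ρ ^ d * ω = 8 * R * T / t := by
    rw [hρ, ← Real.mul_rpow (by positivity) (by positivity), ← Real.rpow_natCast,
      ← Real.rpow_mul (by positivity), one_div_mul_cancel hd0.ne', Real.rpow_one]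
    field_simp
  set Q : Set (EuclideanSpace ℝ (Fin d)) := Metric.ball 0 ρ with hQ
  have hQvol : volume Q = ENNReal.ofReal (8 * R * T / t) := by
    rw [hQ, Measure.addHaar_ball_of_pos _ _ hρ0, finrank_euclideanSpace_fin,
      ← ENNReal.ofReal_toReal hωtop, ← hω, ← ENNReal.ofReal_mul (by positivity), hρd]
  have hL1 := lintegral_le_of_translation_estimate hd hR hsupp hT
  have hm2 : volume {x | t / 2 < w x} ≤ ENNReal.ofReal (4 * R * T / t) := by
    have h1 := meas_ge_le_lintegral_div (μ := volume) (f := fun x => ENNReal.ofReal (w x))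
      (by fun_prop) (ε := ENNReal.ofReal (t / 2)) (by simpa using ht) (by simp)
    calc volume {x | t / 2 < w x}
        ≤ volume {x | ENNReal.ofReal (t / 2) ≤ ENNReal.ofReal (w x)} :=
          measure_mono fun x hx => ENNReal.ofReal_le_ofReal (le_of_lt hx)
      _ ≤ ENNReal.ofReal (2 * R * T) / ENNReal.ofReal (t / 2) :=
          h1.trans (ENNReal.div_le_div_right hL1 _)
      _ = _ := by
          rw [← ENNReal.ofReal_div_of_pos (by positivity)]
          congr 1; field_simp; ring
  have hinner : ∀ x ∈ {x | t < w x}, ENNReal.ofReal (2 * R * T) ≤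
      ∫⁻ h in Q, ENNReal.ofReal |w (x + h) - w x| := by
    intro x hx
    have hx' : t < w x := hx
    have hmeas : MeasurableSet {h | w (x + h) ≤ t / 2} :=
      measurableSet_le (hw.comp (by fun_prop)) measurable_const
    have hpre : volume {h | t / 2 < w (x + h)} = volume {y | t / 2 < w y} := by
      rw [← measure_preimage_add volume x {y | t / 2 < w y}]; rfl
    have hlow : ENNReal.ofReal (4 * R * T / t) ≤ volume ({h | w (x + h) ≤ t / 2} ∩ Q) := by
      have h1 : volume Q ≤ volume ({h | w (x + h) ≤ t / 2} ∩ Q) +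
          volume {h | t / 2 < w (x + h)} := by
        refine (measure_mono ?_).trans (measure_union_le _ _)
        intro h hh
        rcases le_or_gt (w (x + h)) (t / 2) with h2 | h2
        · exact Or.inl ⟨h2, hh⟩
        · exact Or.inr h2
      rw [hpre, hQvol] at h1
      have h2 := h1.trans (add_le_add_right hm2 _)
      have h3 : ENNReal.ofReal (8 * R * T / t) =
          ENNReal.ofReal (4 * R * T / t) + ENNReal.ofReal (4 * R * T / t) := by
        rw [← ENNReal.ofReal_add (by positivity) (by positivity)]; congr 1; ring
      rw [h3] at h2
      exact (ENNReal.add_le_add_iff_right ENNReal.ofReal_ne_top).1 h2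
    calc ENNReal.ofReal (2 * R * T)
        = ENNReal.ofReal (t / 2) * ENNReal.ofReal (4 * R * T / t) := by
          rw [← ENNReal.ofReal_mul (by positivity)]; congr 1; field_simp; ring
      _ ≤ ENNReal.ofReal (t / 2) * volume.restrict Q {h | w (x + h) ≤ t / 2} := by
          rw [Measure.restrict_apply hmeas]; gcongr
      _ = ∫⁻ h in Q, {h | w (x + h) ≤ t / 2}.indicator (fun _ => ENNReal.ofReal (t / 2)) h := by
          rw [lintegral_indicator_const hmeas]
      _ ≤ _ := by
          refine lintegral_mono (Set.indicator_le fun h hh => ?_)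
          apply ENNReal.ofReal_le_ofReal
          rw [abs_sub_comm]
          have : w (x + h) ≤ t / 2 := hh
          exact le_trans (by linarith) (le_abs_self _)
  have hcomb : ENNReal.ofReal (2 * R * T) * volume {x | t < w x} ≤
      ENNReal.ofReal (ρ * T) * ENNReal.ofReal (8 * R * T / t) := by
    have hmt : MeasurableSet {x | t < w x} := measurableSet_lt measurable_const hw
    calc ENNReal.ofReal (2 * R * T) * volume {x | t < w x}
        = ∫⁻ x, {x | t < w x}.indicator (fun _ => ENNReal.ofReal (2 * R * T)) x := by
          rw [lintegral_indicator_const hmt]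
      _ ≤ ∫⁻ x, ∫⁻ h in Q, ENNReal.ofReal |w (x + h) - w x| :=
          lintegral_mono fun x => Set.indicator_le hinner x
      _ = ∫⁻ h in Q, ∫⁻ x, ENNReal.ofReal |w (x + h) - w x| := by
          refine lintegral_lintegral_swap (Measurable.aemeasurable ?_)
          have : Measurable fun z : EuclideanSpace ℝ (Fin d) × EuclideanSpace ℝ (Fin d) =>
              w (z.1 + z.2) - w z.1 :=
            (hw.comp (measurable_fst.add measurable_snd)).sub (hw.comp measurable_fst)
          exact (measurable_norm.comp this).ennreal_ofReal
      _ ≤ ∫⁻ h in Q, ENNReal.ofReal (ρ * T) := by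
          refine setLIntegral_mono measurable_const fun h hh => (hT h).trans ?_
          have : ‖h‖ < ρ := by simpa [hQ] using hh
          gcongr
      _ = _ := by rw [setLIntegral_const, hQvol]
  have hpos : 0 < 2 * R * T := by positivity
  have hne : ENNReal.ofReal (2 * R * T) ≠ 0 := by simpa using hpos
  calc volume {x | t < w x}
      ≤ (ENNReal.ofReal (ρ * T) * ENNReal.ofReal (8 * R * T / t)) /
          ENNReal.ofReal (2 * R * T) := by
        rw [ENNReal.le_div_iff_mul_le (Or.inl hne) (Or.inl ENNReal.ofReal_ne_top), mul_comm]
        exact hcomb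
    _ = ENNReal.ofReal (ρ * T * (8 * R * T / t) / (2 * R * T)) := by
        rw [← ENNReal.ofReal_mul (by positivity), ← ENNReal.ofReal_div_of_pos hpos]
    _ = _ := by
        congr 1
        rw [add_comm (1 : ℝ), Real.rpow_add_one (by positivity), hρ]
        field_simp
        ring

/-- Integrability gain: a nonnegative function supported in a ball whose translates satisfy an
`L¹` estimate of order one is controlled in `L^r` with `r = 1 + 1 / (2 d)`. -/
lemma exists_lintegral_rpow_le_of_translation_estimate (hd : 1 ≤ d) {R : ℝ} (hR : 0 < R) :
    ∃ C : ℝ, 0 < C ∧ ∀ (w : EuclideanSpace ℝ (Fin d) → ℝ) (T : ℝ), Measurable w → (∀ x, 0 ≤ w x) →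
      (∀ x, R ≤ ‖x‖ → w x = 0) → 0 ≤ T →
      (∀ h, ∫⁻ x, ENNReal.ofReal |w (x + h) - w x| ≤ ENNReal.ofReal (‖h‖ * T)) →
      ∫⁻ x, ENNReal.ofReal (w x ^ (1 + 1 / (2 * d) : ℝ)) ≤
        ENNReal.ofReal (C * T ^ (1 + 1 / (2 * d) : ℝ)) := by
  have hd0 : (0 : ℝ) < d := by exact_mod_cast hd
  set r : ℝ := 1 + 1 / (2 * d) with hr
  have hr0 : 0 < r := by positivity
  have hr1 : 0 < r - 1 := by rw [hr]; simp [hd0]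
  have hωtop : volume (Metric.ball (0 : EuclideanSpace ℝ (Fin d)) 1) ≠ ⊤ :=
    measure_ball_lt_top.ne
  have hω0 : 0 < (volume (Metric.ball (0 : EuclideanSpace ℝ (Fin d)) 1)).toReal :=
    ENNReal.toReal_pos (Metric.measure_ball_pos _ _ one_pos).ne' hωtop
  set A : ℝ := 4 * (8 * R / (volume (Metric.ball (0 : EuclideanSpace ℝ (Fin d)) 1)).toReal) ^
    (1 / d : ℝ) with hA
  have hA0 : 0 < A := by positivity
  have hVtop : volume (Metric.ball (0 : EuclideanSpace ℝ (Fin d)) R) ≠ ⊤ := measure_ball_lt_top.ne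
  set V : ℝ := (volume (Metric.ball (0 : EuclideanSpace ℝ (Fin d)) R)).toReal with hV
  refine ⟨r * (V + A * (2 * d)), by positivity, ?_⟩
  intro w T hw hw0 hsupp hT0 hT
  -- If `T = 0`, the `L¹` bound forces `w = 0` almost everywhere.
  rcases hT0.eq_or_lt with rfl | hT0
  · have h := lintegral_le_of_translation_estimate hd hR hsupp hT
    rw [mul_zero, ENNReal.ofReal_zero, nonpos_iff_eq_zero, lintegral_eq_zero_iff (by fun_prop)] at h
    refine le_trans (le_of_eq ?_) zero_le
    rw [lintegral_eq_zero_iff (by fun_prop)]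
    filter_upwards [h] with x hx
    have : w x = 0 := le_antisymm (by simpa using hx) (hw0 x)
    simp [this, Real.zero_rpow hr0.ne']
  rw [lintegral_rpow_eq_lintegral_meas_lt_mul volume (Filter.Eventually.of_forall hw0)
    hw.aemeasurable hr0]
  -- The layer-cake integral is split at `t = T`. Below, the superlevel sets have volume at most
  -- that of the ball. Above, the weak-type bound makes the integrand a multiple of `t^{-r}`,
  -- integrable at infinity since `r > 1`; the factor `2d` is `1/(r - 1)`.
  have hsplit : Set.Ioi (0 : ℝ) = Set.Ioc 0 T ∪ Set.Ioi T := (Set.Ioc_union_Ioi_eq_Ioi hT0.le).symm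
  have h1 : ∫⁻ t in Set.Ioc 0 T, volume {x | t < w x} * ENNReal.ofReal (t ^ (r - 1)) ≤
      ENNReal.ofReal (V * T ^ r) := by
    calc ∫⁻ t in Set.Ioc 0 T, volume {x | t < w x} * ENNReal.ofReal (t ^ (r - 1))
        ≤ ∫⁻ t in Set.Ioc 0 T, ENNReal.ofReal (V * T ^ (r - 1)) := by
          refine setLIntegral_mono measurable_const fun t ht => ?_
          rw [ENNReal.ofReal_mul (by positivity), hV, ENNReal.ofReal_toReal hVtop]
          gcongr
          · intro x hx
            by_contra h
            have : w x = 0 := hsupp x (by simpa using h)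
            have hx' : t < w x := hx
            linarith [ht.1]
          · exact ht.1.le
          · exact ht.2
      _ = _ := by
          rw [setLIntegral_const, Real.volume_Ioc, sub_zero, ← ENNReal.ofReal_mul (by positivity),
            mul_assoc, ← Real.rpow_add_one hT0.ne', sub_add_cancel]
  have h2 : ∫⁻ t in Set.Ioi T, volume {x | t < w x} * ENNReal.ofReal (t ^ (r - 1)) ≤
      ENNReal.ofReal (A * (2 * d) * T ^ r) := by
    have hexp : (-r : ℝ) < -1 := by linarith
    have hint := integrableOn_Ioi_rpow_of_lt hexp hT0
    calc ∫⁻ t in Set.Ioi T, volume {x | t < w x} * ENNReal.ofReal (t ^ (r - 1))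
        ≤ ∫⁻ t in Set.Ioi T, ENNReal.ofReal (A * T ^ (1 + 1 / d : ℝ) * t ^ (-r)) := by
          refine setLIntegral_mono (by fun_prop) fun t ht => ?_
          have ht0 : 0 < t := hT0.trans ht
          refine (mul_le_mul_left
            (volume_lt_le_of_translation_estimate hd hw hR hsupp hT0 hT ht0) _).trans ?_
          rw [← ENNReal.ofReal_mul (by positivity)]
          apply ENNReal.ofReal_le_ofReal
          have e : t ^ (r - 1) = t ^ (1 + 1 / d : ℝ) * t ^ (-r) := by
            rw [← Real.rpow_add ht0]; congr 1; rw [hr]; field_simp; ring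
          rw [← hA, Real.div_rpow hT0.le ht0.le, e]
          apply le_of_eq
          have := (Real.rpow_pos_of_pos ht0 (1 + 1 / d : ℝ)).ne'
          field_simp
      _ = ENNReal.ofReal (∫ t in Set.Ioi T, A * T ^ (1 + 1 / d : ℝ) * t ^ (-r)) := by
          rw [ofReal_integral_eq_lintegral_ofReal (hint.const_mul _)]
          refine (ae_restrict_iff' measurableSet_Ioi).2 (Filter.Eventually.of_forall fun t ht => ?_)
          have ht0 : 0 < t := hT0.trans ht
          show 0 ≤ A * T ^ (1 + 1 / d : ℝ) * t ^ (-r)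
          positivity
      _ = _ := by
          rw [integral_const_mul, integral_Ioi_rpow_of_lt hexp hT0]
          congr 1
          have e : T ^ r = T ^ (1 + 1 / d : ℝ) * T ^ (-r + 1) := by
            rw [← Real.rpow_add hT0]; congr 1; rw [hr]; field_simp; ring
          rw [e, hr]
          field_simp
          ring
  calc ENNReal.ofReal r * ∫⁻ t in Set.Ioi 0, volume {x | t < w x} * ENNReal.ofReal (t ^ (r - 1))
      ≤ ENNReal.ofReal r * (ENNReal.ofReal (V * T ^ r) + ENNReal.ofReal (A * (2 * d) * T ^ r)) := by
        gcongr
        rw [hsplit]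
        exact (lintegral_union_le _ _ _).trans (add_le_add h1 h2)
    _ = _ := by
        rw [← ENNReal.ofReal_add (by positivity) (by positivity), ← ENNReal.ofReal_mul hr0.le]
        congr 1; ring

end Translations

/-! ### Local geometry of cells and edges -/

namespace SpaceDiscretisation

open Filter Topology

variable {d : ℕ} {Ω : Set (EuclideanSpace ℝ (Fin d))} (D : SpaceDiscretisation Ω)
  {K L σ τ : Set (EuclideanSpace ℝ (Fin d))}

lemma mem_cellsOf : K ∈ D.cellsOf σ ↔ K ∈ D.cells ∧ σ ∈ D.edgesOf K := by
  classical
  simp [cellsOf]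

lemma closure_edge_subset_frontier (hK : K ∈ D.cells) (hσ : σ ∈ D.edgesOf K) :
    closure σ ⊆ closure K \ K := by
  rw [D.cell_boundary K hK]
  exact Set.subset_biUnion_of_mem (u := fun σ => closure σ) hσ

lemma edge_subset_frontier (hK : K ∈ D.cells) (hσ : σ ∈ D.edgesOf K) : σ ⊆ closure K \ K :=
  subset_closure.trans (D.closure_edge_subset_frontier hK hσ)

/-- A unit normal and the level of the hyperplane that contains an edge. -/
lemma exists_edge_normal : ∃ (ν : Set (EuclideanSpace ℝ (Fin d)) → EuclideanSpace ℝ (Fin d))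
    (c : Set (EuclideanSpace ℝ (Fin d)) → ℝ), ∀ σ ∈ D.edges, ‖ν σ‖ = 1 ∧
      ∀ x, x ∈ affineSpan ℝ σ ↔ inner ℝ (ν σ) x = c σ := by
  have h : ∀ σ, ∃ (ν : EuclideanSpace ℝ (Fin d)) (c : ℝ), σ ∈ D.edges → ‖ν‖ = 1 ∧
      ∀ x, x ∈ affineSpan ℝ σ ↔ inner ℝ ν x = c := by
    intro σ
    by_cases hσ : σ ∈ D.edges
    · obtain ⟨ν, c, h⟩ := exists_unit_normal (affineSpan ℝ σ)
        ((affineSpan_nonempty ℝ).2 (D.edge_nonempty σ hσ)) (D.edge_hyperplane σ hσ)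
      exact ⟨ν, c, fun _ => h⟩
    · exact ⟨0, 0, fun h => absurd h hσ⟩
  choose ν c h using h
  exact ⟨ν, c, h⟩

/-- The unit normal of the hyperplane containing the edge `σ`. -/
noncomputable def normal (σ : Set (EuclideanSpace ℝ (Fin d))) : EuclideanSpace ℝ (Fin d) :=
  D.exists_edge_normal.choose σ

/-- The level of the hyperplane containing the edge `σ`, with respect to `D.normal σ`. -/
noncomputable def level (σ : Set (EuclideanSpace ℝ (Fin d))) : ℝ :=
  D.exists_edge_normal.choose_spec.choose σ

lemma norm_normal (hσ : σ ∈ D.edges) : ‖D.normal σ‖ = 1 :=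
  (D.exists_edge_normal.choose_spec.choose_spec σ hσ).1

lemma normal_ne_zero (hσ : σ ∈ D.edges) : D.normal σ ≠ 0 := by
  intro h
  have := D.norm_normal hσ
  simp [h] at this

lemma mem_affineSpan_edge (hσ : σ ∈ D.edges) (x : EuclideanSpace ℝ (Fin d)) :
    x ∈ affineSpan ℝ σ ↔ inner ℝ (D.normal σ) x = D.level σ :=
  (D.exists_edge_normal.choose_spec.choose_spec σ hσ).2 x

lemma inner_eq_level (hσ : σ ∈ D.edges) {x : EuclideanSpace ℝ (Fin d)} (hx : x ∈ σ) :
    inner ℝ (D.normal σ) x = D.level σ :=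
  (D.mem_affineSpan_edge hσ x).1 (subset_affineSpan ℝ σ hx)

lemma closure_edge_subset_affineSpan :
    closure σ ⊆ (affineSpan ℝ σ : Set (EuclideanSpace ℝ (Fin d))) :=
  closure_minimal (subset_affineSpan ℝ σ) (AffineSubspace.closed_of_finiteDimensional _)

lemma inner_eq_level_of_mem_closure (hσ : σ ∈ D.edges) {x : EuclideanSpace ℝ (Fin d)}
    (hx : x ∈ closure σ) : inner ℝ (D.normal σ) x = D.level σ :=
  (D.mem_affineSpan_edge hσ x).1 (closure_edge_subset_affineSpan hx)

lemma measurableSet_edge (hσ : σ ∈ D.edges) : MeasurableSet σ := by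
  obtain ⟨U, hU, h⟩ := D.edge_isOpen σ hσ
  rw [h]
  exact hU.measurableSet.inter (AffineSubspace.closed_of_finiteDimensional _).measurableSet

lemma edges_of_mem_edgesOf (hK : K ∈ D.cells) (hσ : σ ∈ D.edgesOf K) : σ ∈ D.edges :=
  D.edgesOf_subset K hK hσ

lemma inner_center_ne_level (hK : K ∈ D.cells) (hσ : σ ∈ D.edgesOf K) :
    inner ℝ (D.normal σ) (D.center K) ≠ D.level σ := by
  intro h
  have := D.center_dist_pos K hK σ hσ
  rw [Metric.infDist_zero_of_mem
    ((D.mem_affineSpan_edge (D.edges_of_mem_edgesOf hK hσ) _).2 h)] at this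
  exact lt_irrefl _ this

lemma cellDist_le (hK : K ∈ D.cells) (hσ : σ ∈ D.edgesOf K) :
    D.cellDist K σ ≤ |D.level σ - inner ℝ (D.normal σ) (D.center K)| := by
  have hσ' := D.edges_of_mem_edgesOf hK hσ
  set δ := D.level σ - inner ℝ (D.normal σ) (D.center K) with hδ
  have hmem : D.center K + δ • D.normal σ ∈ (affineSpan ℝ σ : Set _) := by
    refine (D.mem_affineSpan_edge hσ' _).2 ?_
    rw [inner_add_right, inner_smul_right, real_inner_self_eq_norm_sq, D.norm_normal hσ']
    simp [hδ]
  refine (Metric.infDist_le_dist_of_mem hmem).trans (le_of_eq ?_)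
  rw [dist_eq_norm, sub_add_cancel_left, norm_neg, norm_smul, D.norm_normal hσ', mul_one,
    Real.norm_eq_abs]

lemma cellDist_pos (hK : K ∈ D.cells) (hσ : σ ∈ D.edgesOf K) : 0 < D.cellDist K σ :=
  D.center_dist_pos K hK σ hσ

lemma center_add_smul_mem (hK : K ∈ D.cells) {y : EuclideanSpace ℝ (Fin d)} (hy : y ∈ K) {r : ℝ}
    (h0 : 0 ≤ r) (h1 : r ≤ 1) : D.center K + r • (y - D.center K) ∈ K :=
  (D.cell_starConvex K hK).add_smul_sub_mem hy h0 h1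

/-- The half-open segment from the cell point to a point of the closed cell lies in the cell. -/
lemma center_add_smul_mem_of_mem_closure (hK : K ∈ D.cells) {y : EuclideanSpace ℝ (Fin d)}
    (hy : y ∈ closure K) {r : ℝ} (h0 : 0 ≤ r) (h1 : r < 1) :
    D.center K + r • (y - D.center K) ∈ K := by
  set x := D.center K with hx
  have hcl : ∀ s : ℝ, 0 ≤ s → s ≤ 1 → x + s • (y - x) ∈ closure K := by
    intro s hs0 hs1
    have hc : Continuous fun z : EuclideanSpace ℝ (Fin d) => x + s • (z - x) := by fun_prop
    exact map_mem_closure (f := fun z => x + s • (z - x)) hc hy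
      fun z hz => D.center_add_smul_mem hK hz hs0 hs1
  -- The hyperplane of an edge of `K` misses the cell point, so a line through that point meets it
  -- at most once. Thus the segment meets the boundary of `K` finitely often, and some `s` in `(r,
  -- 1)` gives a point of `K`, from which star-shapedness leads back to `r`.
  have hfin : {s : ℝ | x + s • (y - x) ∈ closure K \ K}.Finite := by
    rw [D.cell_boundary K hK]
    have : {s : ℝ | x + s • (y - x) ∈ ⋃ σ ∈ D.edgesOf K, closure σ} =
        ⋃ σ ∈ D.edgesOf K, {s : ℝ | x + s • (y - x) ∈ closure σ} := by
      ext s; simp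
    rw [this]
    refine Set.Finite.biUnion (Finset.finite_toSet _) fun σ hσ => Set.Subsingleton.finite ?_
    intro s hs s' hs'
    have hσ' := D.edges_of_mem_edgesOf hK hσ
    have e1 := D.inner_eq_level_of_mem_closure hσ' hs
    have e2 := D.inner_eq_level_of_mem_closure hσ' hs'
    have e3 := D.inner_center_ne_level hK hσ
    rw [inner_add_right, inner_smul_right] at e1 e2
    have h4 : inner ℝ (D.normal σ) (y - x) ≠ 0 := by
      intro h; rw [h, mul_zero, add_zero] at e1; exact e3 e1
    have : (s - s') * inner ℝ (D.normal σ) (y - x) = 0 := by linarith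
    rcases mul_eq_zero.1 this with h | h
    · linarith
    · exact absurd h h4
  obtain ⟨s, hs, hs'⟩ := (Set.Ioo_infinite h1).exists_notMem_finite hfin
  have hs0 : 0 < s := h0.trans_lt hs.1
  have hsK : x + s • (y - x) ∈ K := by
    by_contra h
    exact hs' ⟨hcl s hs0.le hs.2.le, h⟩
  have := D.center_add_smul_mem hK hsK (r := r / s) (by positivity)
    ((div_le_one hs0).2 hs.1.le)
  rwa [← hx, add_sub_cancel_left, smul_smul, div_mul_cancel₀ _ hs0.ne'] at this

/-- Near an edge of `K`, on the side of the cell point, one is in `K`. -/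
lemma eventually_mem_cell (hK : K ∈ D.cells) (hσ : σ ∈ D.edgesOf K)
    {z : EuclideanSpace ℝ (Fin d)} (hz : z ∈ σ) :
    ∀ᶠ y in 𝓝 z, 0 < (inner ℝ (D.normal σ) y - D.level σ) *
      (inner ℝ (D.normal σ) (D.center K) - D.level σ) → y ∈ K := by
  have hσ' := D.edges_of_mem_edgesOf hK hσ
  set x := D.center K with hx
  set a := inner ℝ (D.normal σ) x - D.level σ with ha
  have ha0 : a ≠ 0 := sub_ne_zero.2 (D.inner_center_ne_level hK hσ)
  have hz0 : inner ℝ (D.normal σ) z - D.level σ = 0 := sub_eq_zero.2 (D.inner_eq_level hσ' hz)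
  obtain ⟨U, hU, hUσ⟩ := D.edge_isOpen σ hσ'
  let l : EuclideanSpace ℝ (Fin d) → ℝ := fun y => inner ℝ (D.normal σ) y - D.level σ
  have hl : Continuous l := by fun_prop
  -- Central projection from the cell point onto the hyperplane of `σ`. It is continuous at `z` and
  -- fixes `z`, so it sends nearby points into the relatively open set `σ`.
  let π : EuclideanSpace ℝ (Fin d) → EuclideanSpace ℝ (Fin d) :=
    fun y => x + (a / (a - l y)) • (y - x)
  have hlz : l z = 0 := hz0
  have hπ : ContinuousAt π z := by
    have h1 : ContinuousAt (fun y => a / (a - l y)) z :=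
      continuousAt_const.div (continuousAt_const.sub hl.continuousAt)
        (by rw [hlz, sub_zero]; exact ha0)
    exact continuousAt_const.add (h1.smul (continuousAt_id.sub continuousAt_const))
  have hπz : π z = z := by simp [π, hlz, ha0]
  have hzU : z ∈ U := by rw [hUσ] at hz; exact hz.1
  have hev1 : ∀ᶠ y in 𝓝 z, π y ∈ U :=
    hπ.eventually (hU.mem_nhds (by rw [hπz]; exact hzU))
  have hev2 : ∀ᶠ y in 𝓝 z, |l y| < |a| :=
    (hl.abs.tendsto z).eventually (gt_mem_nhds (by rw [hlz, abs_zero]; exact abs_pos.2 ha0))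
  filter_upwards [hev1, hev2] with y hy1 hy2 hpos
  have hpos' : 0 < l y * a := hpos
  have hne : a - l y ≠ 0 := by
    intro h
    rw [sub_eq_zero.1 h] at hy2
    exact lt_irrefl _ hy2
  have hmem : π y ∈ σ := by
    rw [hUσ]
    refine ⟨hy1, (D.mem_affineSpan_edge hσ' _).2 ?_⟩
    simp only [π]
    rw [inner_add_right, inner_smul_right, inner_sub_right]
    have e1 : inner ℝ (D.normal σ) y = l y + D.level σ := by simp [l]
    have e2 : inner ℝ (D.normal σ) x = a + D.level σ := by simp [ha]
    rw [e1, e2]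
    field_simp
    ring
  -- The position of `y` on the segment from the cell point to `π y`; it is less than `1` because
  -- `y` is on the cell point's side.
  have hr : 0 ≤ (a - l y) / a ∧ (a - l y) / a < 1 := by
    have : (a - l y) / a = 1 - l y / a := by field_simp
    have h1 : 0 < l y / a := by
      have : l y / a = l y * a / (a * a) := by field_simp
      rw [this]; exact div_pos hpos' (mul_self_pos.2 ha0)
    have h2 : |l y / a| < 1 := by rw [abs_div, div_lt_one (abs_pos.2 ha0)]; exact hy2
    rw [abs_lt] at h2
    constructor <;> linarith [h2.2]
  have := D.center_add_smul_mem_of_mem_closure hK (D.edge_subset_frontier hK hσ hmem).1 hr.1 hr.2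
  have e : D.center K + ((a - l y) / a) • (π y - D.center K) = y := by
    simp only [π]
    rw [← hx, add_sub_cancel_left, smul_smul, div_mul_div_cancel₀ ha0, div_self hne, one_smul,
      add_sub_cancel]
  rwa [e] at this

/-- Two cells that share an edge lie on opposite sides of it. -/
lemma opposite_sides (hK : K ∈ D.cells) (hL : L ∈ D.cells) (hKL : K ≠ L)
    (hσK : σ ∈ D.edgesOf K) (hσL : σ ∈ D.edgesOf L) :
    (inner ℝ (D.normal σ) (D.center K) - D.level σ) *
      (inner ℝ (D.normal σ) (D.center L) - D.level σ) < 0 := by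
  have hσ' := D.edges_of_mem_edgesOf hK hσK
  by_contra hcon
  have hK0 := sub_ne_zero.2 (D.inner_center_ne_level hK hσK)
  have hL0 := sub_ne_zero.2 (D.inner_center_ne_level hL hσL)
  set a := inner ℝ (D.normal σ) (D.center K) - D.level σ with ha
  set b := inner ℝ (D.normal σ) (D.center L) - D.level σ with hb
  have hab : 0 < a * b := lt_of_le_of_ne (not_lt.1 hcon) (mul_ne_zero hK0 hL0).symm
  obtain ⟨z, hz⟩ := D.edge_nonempty σ hσ'
  -- Were both cell points on the same side, the points near `z` on the way to `x_K` would belong to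
  -- both cells.
  have hc : Tendsto (fun t : ℝ => z + t • (D.center K - z)) (𝓝[>] 0) (𝓝 z) := by
    have : Continuous fun t : ℝ => z + t • (D.center K - z) := by fun_prop
    have := this.tendsto 0
    simp only [zero_smul, add_zero] at this
    exact this.mono_left nhdsWithin_le_nhds
  have hl : ∀ t : ℝ, inner ℝ (D.normal σ) (z + t • (D.center K - z)) - D.level σ = t * a := by
    intro t
    rw [inner_add_right, inner_smul_right, inner_sub_right, D.inner_eq_level hσ' hz, ha]
    ring
  have hev := ((hc.eventually (D.eventually_mem_cell hK hσK hz)).and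
    (hc.eventually (D.eventually_mem_cell hL hσL hz))).and self_mem_nhdsWithin
  obtain ⟨t, ⟨h1, h2⟩, ht⟩ := hev.exists
  have ht0 : (0 : ℝ) < t := ht
  rw [hl, ← ha] at h1
  rw [hl, ← hb] at h2
  have m1 := h1 (by rw [mul_assoc]; exact mul_pos ht0 (mul_self_pos.2 hK0))
  have m2 := h2 (by rw [mul_assoc]; exact mul_pos ht0 hab)
  exact Set.disjoint_left.1 (D.cells_disjoint K hK L hL hKL) m1 m2

lemma cellsOf_nonempty (hσ : σ ∈ D.edges) : (D.cellsOf σ).Nonempty := by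
  classical
  rw [Finset.nonempty_iff_ne_empty]
  intro h
  have e : {K | K ∈ D.cells ∧ σ ∈ D.edgesOf K} = ∅ := by
    ext K
    simp only [Set.mem_ofPred_eq, Set.mem_empty_iff_false, iff_false]
    intro hK
    have := D.mem_cellsOf.2 hK
    simp [h] at this
  rcases D.edge_cells σ hσ with h1 | h1 <;> simp [e] at h1

lemma card_cellsOf (hσ : σ ∈ D.edges) : (D.cellsOf σ).card = 1 ∨ (D.cellsOf σ).card = 2 := by
  have e : {K | K ∈ D.cells ∧ σ ∈ D.edgesOf K} = (D.cellsOf σ : Set _) := by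
    ext K; simp [D.mem_cellsOf]
  have := D.edge_cells σ hσ
  rw [e, Set.ncard_coe_finset] at this
  tauto

/-- Near a point of `σ` away from the other edges only the cells having `σ` as an edge occur. -/
lemma eventually_edge_of_mem_cell (hσ : σ ∈ D.edges) {z : EuclideanSpace ℝ (Fin d)} (hz : z ∈ σ)
    (hz' : ∀ τ ∈ D.edges, τ ≠ σ → z ∉ closure τ) :
    ∀ᶠ y in 𝓝 z, ∀ K ∈ D.cells, y ∈ K → σ ∈ D.edgesOf K := by
  rw [eventually_all_finset]
  intro K hK
  by_cases hσK : σ ∈ D.edgesOf K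
  · exact Eventually.of_forall fun _ _ => hσK
  obtain ⟨K', hK'⟩ := D.cellsOf_nonempty hσ
  rw [D.mem_cellsOf] at hK'
  have hzK' := D.edge_subset_frontier hK'.1 hK'.2 hz
  -- A point of an edge belongs to no cell: an open cell containing it would meet the cell `K'` that
  -- has it on its boundary.
  have hzK : z ∉ K := by
    intro h
    obtain ⟨y, hy, hy'⟩ := mem_closure_iff.1 hzK'.1 K (D.cell_isOpen K hK) h
    by_cases hKK : K = K'
    · exact hzK'.2 (hKK ▸ h)
    · exact Set.disjoint_left.1 (D.cells_disjoint K hK K' hK'.1 hKK) hy hy'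
  have hzcl : z ∉ closure K := by
    intro h
    have : z ∈ closure K \ K := ⟨h, hzK⟩
    rw [D.cell_boundary K hK] at this
    simp only [Set.mem_iUnion, exists_prop] at this
    obtain ⟨τ, hτ, hzτ⟩ := this
    by_cases hτσ : τ = σ
    · exact hσK (hτσ ▸ hτ)
    · exact hz' τ (D.edges_of_mem_edgesOf hK hτ) hτσ hzτ
  filter_upwards [isClosed_closure.isOpen_compl.mem_nhds hzcl] with y hy hyK
  exact absurd (subset_closure hyK) hy

/-- The piecewise constant function with cell values `f`, extended by zero. -/
noncomputable def cellFun (f : Set (EuclideanSpace ℝ (Fin d)) → ℝ) (x : EuclideanSpace ℝ (Fin d)) : ℝ :=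
  ∑ K ∈ D.cells, K.indicator (fun _ => f K) x

/-! ### Piecewise constant functions and their translates -/

section CellFunctions

variable (f : Set (EuclideanSpace ℝ (Fin d)) → ℝ)

lemma measurable_cellFun : Measurable (D.cellFun f) :=
  Finset.measurable_fun_sum _ fun K hK =>
    measurable_const.indicator (D.cell_isOpen K hK).measurableSet

lemma cellFun_of_mem (hK : K ∈ D.cells) {x : EuclideanSpace ℝ (Fin d)} (hx : x ∈ K) :
    D.cellFun f x = f K := by
  rw [cellFun, Finset.sum_eq_single_of_mem K hK, Set.indicator_of_mem hx]
  intro L hL hLK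
  exact Set.indicator_of_notMem
    (fun h => Set.disjoint_left.1 (D.cells_disjoint L hL K hK hLK) h hx) _

lemma cellFun_of_forall_notMem {x : EuclideanSpace ℝ (Fin d)} (hx : ∀ K ∈ D.cells, x ∉ K) :
    D.cellFun f x = 0 :=
  Finset.sum_eq_zero fun K hK => Set.indicator_of_notMem (hx K hK) _

lemma jump_nonneg : 0 ≤ D.jump f K σ := abs_nonneg _

lemma jump_of_cellsOf_eq_singleton (h : D.cellsOf σ = {K}) : D.jump f K σ = |f K| := by
  classical
  rw [jump, h]; simp

lemma jump_of_cellsOf_eq_pair (hKL : K ≠ L) (h : D.cellsOf σ = {K, L}) :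
    D.jump f K σ = |f K - f L| := by
  classical
  have e : ({K, L} : Finset (Set (EuclideanSpace ℝ (Fin d)))).erase K = {L} := by
    ext M
    simp only [Finset.mem_erase, Finset.mem_insert, Finset.mem_singleton]
    constructor
    · rintro ⟨h1, h2 | h2⟩
      · exact absurd h2 h1
      · exact h2
    · rintro rfl
      exact ⟨hKL.symm, Or.inr rfl⟩
  unfold jump
  rw [h]
  have e' := congrArg (fun s => |f K - ∑ L ∈ s, f L|) e
  simpa using e'

/-- The oscillation of a piecewise constant function across an edge. -/
lemma eventually_abs_cellFun_sub_le (hσ : σ ∈ D.edges) {z : EuclideanSpace ℝ (Fin d)} (hz : z ∈ σ)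
    (hz' : ∀ τ ∈ D.edges, τ ≠ σ → z ∉ closure τ) :
    ∃ U ∈ 𝓝 z, ∀ y ∈ U, ∀ y' ∈ U, inner ℝ (D.normal σ) y ≠ D.level σ →
      inner ℝ (D.normal σ) y' ≠ D.level σ →
      |D.cellFun f y - D.cellFun f y'| ≤ ∑ K ∈ D.cellsOf σ, D.jump f K σ := by
  classical
  have hev := D.eventually_edge_of_mem_cell hσ hz hz'
  rcases D.card_cellsOf hσ with hcard | hcard
  · obtain ⟨K, hK⟩ := Finset.card_eq_one.1 hcard
    have hKm := D.mem_cellsOf.1 (show K ∈ D.cellsOf σ by simp [hK])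
    refine ⟨_, hev, fun y hy y' hy' _ _ => ?_⟩
    -- With a single adjacent cell, only the values `f K` and `0` occur near `z`.
    have key : ∀ y, (∀ K ∈ D.cells, y ∈ K → σ ∈ D.edgesOf K) →
        D.cellFun f y = f K ∨ D.cellFun f y = 0 := by
      intro y hy
      by_cases hyK : y ∈ K
      · exact Or.inl (D.cellFun_of_mem f hKm.1 hyK)
      · refine Or.inr (D.cellFun_of_forall_notMem f fun L hL hyL => ?_)
        have : L ∈ D.cellsOf σ := D.mem_cellsOf.2 ⟨hL, hy L hL hyL⟩
        rw [hK, Finset.mem_singleton] at this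
        exact hyK (this ▸ hyL)
    rw [hK, Finset.sum_singleton, D.jump_of_cellsOf_eq_singleton f hK]
    rcases key y hy with h | h <;> rcases key y' hy' with h' | h' <;> rw [h, h'] <;> simp
  · obtain ⟨K, L, hKL, hcells⟩ := Finset.card_eq_two.1 hcard
    have hKm := D.mem_cellsOf.1 (show K ∈ D.cellsOf σ by simp [hcells])
    have hLm := D.mem_cellsOf.1 (show L ∈ D.cellsOf σ by simp [hcells])
    have hopp := D.opposite_sides hKm.1 hLm.1 hKL hKm.2 hLm.2
    have hev' := (D.eventually_mem_cell hKm.1 hKm.2 hz).and (D.eventually_mem_cell hLm.1 hLm.2 hz)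
    refine ⟨_, hev', fun y hy y' hy' hne hne' => ?_⟩
    set a := inner ℝ (D.normal σ) (D.center K) - D.level σ
    set b := inner ℝ (D.normal σ) (D.center L) - D.level σ
    -- The two cell points lie on opposite sides, so near `z` each point off the hyperplane is in
    -- `K` or in `L`.
    have key : ∀ y, ((0 < (inner ℝ (D.normal σ) y - D.level σ) * a → y ∈ K) ∧
        (0 < (inner ℝ (D.normal σ) y - D.level σ) * b → y ∈ L)) →
        inner ℝ (D.normal σ) y ≠ D.level σ → D.cellFun f y = f K ∨ D.cellFun f y = f L := by
      intro y hy hne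
      rcases mul_neg_iff.1 hopp with ⟨h1, h2⟩ | ⟨h1, h2⟩ <;>
        rcases lt_or_gt_of_ne (sub_ne_zero.2 hne) with h3 | h3
      · exact Or.inr (D.cellFun_of_mem f hLm.1 (hy.2 (mul_pos_of_neg_of_neg h3 h2)))
      · exact Or.inl (D.cellFun_of_mem f hKm.1 (hy.1 (mul_pos h3 h1)))
      · exact Or.inl (D.cellFun_of_mem f hKm.1 (hy.1 (mul_pos_of_neg_of_neg h3 h1)))
      · exact Or.inr (D.cellFun_of_mem f hLm.1 (hy.2 (mul_pos h3 h2)))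
    have hjump : |f K - f L| ≤ ∑ M ∈ D.cellsOf σ, D.jump f M σ := by
      rw [← D.jump_of_cellsOf_eq_pair f hKL hcells]
      exact Finset.single_le_sum (f := fun M => D.jump f M σ) (fun M _ => D.jump_nonneg f)
        (D.mem_cellsOf.2 hKm)
    refine le_trans ?_ hjump
    rcases key y hy hne with h | h <;> rcases key y' hy' hne' with h' | h' <;> rw [h, h']
    · simp
    · exact (abs_sub_comm _ _).le
    · simp

lemma eventually_cellFun_eq {z : EuclideanSpace ℝ (Fin d)}
    (hz : ∀ σ ∈ D.edges, z ∉ closure σ) : ∀ᶠ y in 𝓝 z, D.cellFun f y = D.cellFun f z := by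
  by_cases h : ∃ K ∈ D.cells, z ∈ K
  · obtain ⟨K, hK, hzK⟩ := h
    filter_upwards [(D.cell_isOpen K hK).mem_nhds hzK] with y hy
    rw [D.cellFun_of_mem f hK hy, D.cellFun_of_mem f hK hzK]
  · push Not at h
    have hcl : ∀ K ∈ D.cells, z ∉ closure K := by
      intro K hK hzK
      have : z ∈ closure K \ K := ⟨hzK, h K hK⟩
      rw [D.cell_boundary K hK] at this
      simp only [Set.mem_iUnion, exists_prop] at this
      obtain ⟨τ, hτ, hzτ⟩ := this
      exact hz τ (D.edges_of_mem_edgesOf hK hτ) hzτ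
    have hev : ∀ᶠ y in 𝓝 z, ∀ K ∈ D.cells, y ∉ K := by
      rw [eventually_all_finset]
      intro K hK
      filter_upwards [isClosed_closure.isOpen_compl.mem_nhds (hcl K hK)] with y hy hyK
      exact hy (subset_closure hyK)
    filter_upwards [hev] with y hy
    rw [D.cellFun_of_forall_notMem f hy, D.cellFun_of_forall_notMem f h]

lemma sum_edges_cellsOf (F : Set (EuclideanSpace ℝ (Fin d)) → Set (EuclideanSpace ℝ (Fin d)) → ℝ) :
    ∑ σ ∈ D.edges, ∑ K ∈ D.cellsOf σ, F K σ = ∑ K ∈ D.cells, ∑ σ ∈ D.edgesOf K, F K σ := by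
  refine Finset.sum_comm' fun σ K => ?_
  rw [D.mem_cellsOf]
  constructor
  · rintro ⟨-, h1, h2⟩
    exact ⟨h2, h1⟩
  · rintro ⟨h1, h2⟩
    exact ⟨D.edges_of_mem_edgesOf h2 h1, h2, h1⟩

/-- Eliminating `s` from the two equations leaves one linear equation for `x`. It describes a
hyperplane unless its coefficients vanish; in that case the two hyperplanes are parallel, and a
common point would make them equal. -/
lemma volume_cross_eq_zero (hσ : σ ∈ D.edges) (hτ : τ ∈ D.edges)
    (hne : affineSpan ℝ σ ≠ affineSpan ℝ τ) (h : EuclideanSpace ℝ (Fin d)) :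
    volume {x | ∃ s : ℝ, x + s • h ∈ affineSpan ℝ σ ∧ x + s • h ∈ affineSpan ℝ τ} = 0 := by
  simp only [D.mem_affineSpan_edge hσ, D.mem_affineSpan_edge hτ, inner_add_right, inner_smul_right]
  set b : ℝ := inner ℝ (D.normal σ) h
  set b' : ℝ := inner ℝ (D.normal τ) h
  by_cases hb : b = 0
  · refine measure_mono_null ?_ (volume_hyperplane_eq_zero (D.normal_ne_zero hσ) (D.level σ))
    rintro x ⟨s, hs, -⟩
    simpa [hb] using hs
  by_cases hb' : b' = 0
  · refine measure_mono_null ?_ (volume_hyperplane_eq_zero (D.normal_ne_zero hτ) (D.level τ))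
    rintro x ⟨s, -, hs⟩
    simpa [hb'] using hs
  have hsub : ∀ x : EuclideanSpace ℝ (Fin d), (∃ s : ℝ, inner ℝ (D.normal σ) x + s * b = D.level σ ∧
      inner ℝ (D.normal τ) x + s * b' = D.level τ) →
      inner ℝ (b' • D.normal σ - b • D.normal τ) x = b' * D.level σ - b * D.level τ := by
    rintro x ⟨s, h1, h2⟩
    rw [inner_sub_left, inner_smul_left, inner_smul_left, ← h1, ← h2]
    simp only [conj_trivial]
    ring
  by_cases ha : b' • D.normal σ - b • D.normal τ = 0
  · convert measure_empty (μ := (volume : Measure (EuclideanSpace ℝ (Fin d))))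
    ext x
    simp only [Set.mem_ofPred_eq, Set.mem_empty_iff_false, iff_false]
    intro hx
    have hlev := hsub x hx
    rw [ha, inner_zero_left] at hlev
    apply hne
    ext y
    rw [D.mem_affineSpan_edge hσ, D.mem_affineSpan_edge hτ]
    have h1 : b' * inner ℝ (D.normal σ) y = b * inner ℝ (D.normal τ) y := by
      have := congrArg (fun a => inner ℝ a y) ha
      simp only [inner_sub_left, inner_smul_left, conj_trivial, inner_zero_left] at this
      linarith
    have h2 : b' * D.level σ = b * D.level τ := by linarith
    rw [← mul_right_inj' hb', h1, h2, mul_right_inj' hb]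
  · exact measure_mono_null hsub (volume_hyperplane_eq_zero ha _)

/-- For edges in one hyperplane, `σ` is relatively open and disjoint from `τ`, so it misses the
closure of `τ`. Otherwise a common point would lie on both hyperplanes, which general position
excludes. -/
lemma notMem_closure_of_ne (hσ : σ ∈ D.edges) (hτ : τ ∈ D.edges) (hne : τ ≠ σ)
    {z : EuclideanSpace ℝ (Fin d)} (hz : z ∈ σ)
    (hcross : affineSpan ℝ σ ≠ affineSpan ℝ τ →
      ¬ (z ∈ affineSpan ℝ σ ∧ z ∈ affineSpan ℝ τ)) : z ∉ closure τ := by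
  intro hzτ
  by_cases hspan : affineSpan ℝ σ = affineSpan ℝ τ
  · obtain ⟨U, hU, hUσ⟩ := D.edge_isOpen σ hσ
    have hzU : z ∈ U := by rw [hUσ] at hz; exact hz.1
    obtain ⟨y, hyU, hyτ⟩ := mem_closure_iff.1 hzτ U hU hzU
    have hyσ : y ∈ σ := by
      rw [hUσ]
      exact ⟨hyU, by rw [hspan]; exact subset_affineSpan ℝ τ hyτ⟩
    exact Set.disjoint_left.1 (D.edges_disjoint τ hτ σ hσ hne) hyτ hyσ
  · exact hcross hspan ⟨subset_affineSpan ℝ σ hz, closure_edge_subset_affineSpan hzτ⟩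

/-- Along a segment in general position a piecewise constant function varies by at most the sum of
the jumps across the edges met. -/
lemma abs_cellFun_sub_le_sum {x h : EuclideanSpace ℝ (Fin d)}
    (hx0 : ∀ σ ∈ D.edges, inner ℝ (D.normal σ) x ≠ D.level σ)
    (hx1 : ∀ σ ∈ D.edges, inner ℝ (D.normal σ) (x + h) ≠ D.level σ)
    (hbd : ∀ σ ∈ D.edges, ∀ s : ℝ, x + s • h ∉ closure σ \ σ)
    (hcross : ∀ σ ∈ D.edges, ∀ τ ∈ D.edges, affineSpan ℝ σ ≠ affineSpan ℝ τ → ∀ s : ℝ,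
      ¬ (x + s • h ∈ affineSpan ℝ σ ∧ x + s • h ∈ affineSpan ℝ τ)) :
    |D.cellFun f (x + h) - D.cellFun f x| ≤ ∑ σ ∈ D.edges,
      {x | ∃ s ∈ Set.Icc (0 : ℝ) 1, x + s • h ∈ σ}.indicator
        (fun _ => ∑ K ∈ D.cellsOf σ, D.jump f K σ) x := by
  classical
  let F := D.edges.filter fun σ => ∃ s ∈ Set.Icc (0 : ℝ) 1, x + s • h ∈ σ
  -- The time at which the line meets the hyperplane of `σ`. The default value of the division for
  -- parallel `h` is harmless: `x` is off the hyperplane, so a line that meets it is not parallel to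
  -- it.
  let t : Set (EuclideanSpace ℝ (Fin d)) → ℝ := fun σ =>
    (D.level σ - inner ℝ (D.normal σ) x) / inner ℝ (D.normal σ) h
  let j : Set (EuclideanSpace ℝ (Fin d)) → ℝ := fun σ => ∑ K ∈ D.cellsOf σ, D.jump f K σ
  have hj : ∀ σ, 0 ≤ j σ := fun σ => Finset.sum_nonneg fun K _ => D.jump_nonneg f
  have htime : ∀ σ ∈ D.edges, ∀ s : ℝ, inner ℝ (D.normal σ) (x + s • h) = D.level σ → s = t σ := by
    intro σ hσ s hs
    rw [inner_add_right, inner_smul_right] at hs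
    have hne : inner ℝ (D.normal σ) h ≠ 0 := by
      intro h0
      rw [h0, mul_zero, add_zero] at hs
      exact hx0 σ hσ hs
    simp only [t]
    rw [← hs]; field_simp; ring
  have hFt : ∀ σ ∈ F, σ ∈ D.edges ∧ x + t σ • h ∈ σ := by
    intro σ hσF
    obtain ⟨hσ, s, hs, hsσ⟩ := Finset.mem_filter.1 hσF
    have := htime σ hσ s (D.inner_eq_level hσ hsσ)
    exact ⟨hσ, this ▸ hsσ⟩
  have hcont : Continuous fun s : ℝ => x + s • h := by fun_prop
  have main := abs_sub_le_sum_of_finite_jumps (g := fun s : ℝ => D.cellFun f (x + s • h)) (t := t)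
    (j := j) hj F 0 1 zero_le_one ?_ ?_ ?_
  · simp only [one_smul, zero_smul, add_zero] at main
    refine main.trans (le_of_eq ?_)
    rw [Finset.sum_filter]
    refine Finset.sum_congr rfl fun σ _ => ?_
    simp only [Set.indicator_apply, Set.mem_ofPred_eq, j]
  · intro σ hσF
    obtain ⟨hσ, hm⟩ := hFt σ hσF
    have hl := D.inner_eq_level hσ hm
    constructor
    · intro h0
      rw [h0, zero_smul, add_zero] at hl
      exact hx0 σ hσ hl
    · intro h1
      rw [h1, one_smul] at hl
      exact hx1 σ hσ hl
  · intro s hs hsF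
    refine hcont.continuousAt.eventually (D.eventually_cellFun_eq f fun σ hσ hcl => ?_)
    have hmem : x + s • h ∈ σ := by
      by_contra hn
      exact hbd σ hσ s ⟨hcl, hn⟩
    exact hsF σ (Finset.mem_filter.2 ⟨hσ, s, hs, hmem⟩)
      (htime σ hσ s (D.inner_eq_level hσ hmem)).symm
  · intro σ hσF _
    obtain ⟨hσ, hm⟩ := hFt σ hσF
    obtain ⟨U, hU, hosc⟩ := D.eventually_abs_cellFun_sub_le f hσ hm
      (fun τ hτ hne => D.notMem_closure_of_ne hσ hτ hne hm
        fun hs => hcross σ hσ τ hτ hs (t σ))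
    obtain ⟨ε, hε, hball⟩ := Metric.mem_nhds_iff.1 (hcont.continuousAt.preimage_mem_nhds hU)
    refine ⟨ε, hε, fun s s' hs hs' hsε hsε' => hosc _ (hball ?_) _ (hball ?_) ?_ ?_⟩
    · simpa [Real.dist_eq] using hsε
    · simpa [Real.dist_eq] using hsε'
    · exact fun h => hs (htime σ hσ s h)
    · exact fun h => hs' (htime σ hσ s' h)

lemma ae_inner_ne_level (hσ : σ ∈ D.edges) (h : EuclideanSpace ℝ (Fin d)) :
    ∀ᵐ x : EuclideanSpace ℝ (Fin d), inner ℝ (D.normal σ) (x + h) ≠ D.level σ := by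
  rw [ae_iff]
  refine measure_mono_null ?_ (volume_hyperplane_eq_zero (D.normal_ne_zero hσ)
    (D.level σ - inner ℝ (D.normal σ) h))
  intro x hx
  have hx' : inner ℝ (D.normal σ) (x + h) = D.level σ := not_not.1 hx
  rw [inner_add_right] at hx'
  show inner ℝ (D.normal σ) x = _
  linarith

lemma ae_abs_cellFun_sub_le_sum (h : EuclideanSpace ℝ (Fin d)) :
    ∀ᵐ x, |D.cellFun f (x + h) - D.cellFun f x| ≤ ∑ σ ∈ D.edges,
      {x | ∃ s ∈ Set.Icc (0 : ℝ) 1, x + s • h ∈ σ}.indicator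
        (fun _ => ∑ K ∈ D.cellsOf σ, D.jump f K σ) x := by
  have h0 : ∀ᵐ x : EuclideanSpace ℝ (Fin d), ∀ σ ∈ D.edges,
      inner ℝ (D.normal σ) x ≠ D.level σ := by
    rw [eventually_all_finset]
    intro σ hσ
    simpa using D.ae_inner_ne_level hσ 0
  have h1 : ∀ᵐ x : EuclideanSpace ℝ (Fin d), ∀ σ ∈ D.edges,
      inner ℝ (D.normal σ) (x + h) ≠ D.level σ := by
    rw [eventually_all_finset]
    exact fun σ hσ => D.ae_inner_ne_level hσ h
  have h2 : ∀ᵐ x : EuclideanSpace ℝ (Fin d), ∀ σ ∈ D.edges, ∀ s : ℝ,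
      x + s • h ∉ closure σ \ σ := by
    rw [eventually_all_finset]
    intro σ hσ
    rw [ae_iff]
    -- All times are allowed: the infinite length of `ℝ` is multiplied by the zero measure of the
    -- edge boundary, and the product is `0`.
    have hle := volume_sweep_le (D.norm_normal hσ)
      (isClosed_closure.measurableSet.diff (D.measurableSet_edge hσ))
      (fun x hx => D.inner_eq_level_of_mem_closure hσ hx.1) MeasurableSet.univ h
    rw [D.edge_boundary_null σ hσ, mul_zero, nonpos_iff_eq_zero] at hle
    refine measure_mono_null ?_ hle
    intro x hx
    have hx' : ¬ ∀ s : ℝ, x + s • h ∉ closure σ \ σ := hx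
    push Not at hx'
    obtain ⟨s, hs⟩ := hx'
    exact ⟨s, trivial, hs⟩
  have h3 : ∀ᵐ x : EuclideanSpace ℝ (Fin d), ∀ σ ∈ D.edges, ∀ τ ∈ D.edges,
      affineSpan ℝ σ ≠ affineSpan ℝ τ → ∀ s : ℝ,
      ¬ (x + s • h ∈ affineSpan ℝ σ ∧ x + s • h ∈ affineSpan ℝ τ) := by
    rw [eventually_all_finset]
    intro σ hσ
    rw [eventually_all_finset]
    intro τ hτ
    by_cases hne : affineSpan ℝ σ = affineSpan ℝ τ
    · exact Eventually.of_forall fun x hx => absurd hne hx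
    · rw [ae_iff]
      refine measure_mono_null ?_ (D.volume_cross_eq_zero hσ hτ hne h)
      intro x hx
      by_contra hcon
      exact hx fun _ s hs => hcon ⟨s, hs⟩
  filter_upwards [h0, h1, h2, h3] with x hx0 hx1 hx2 hx3
  exact D.abs_cellFun_sub_le_sum f hx0 hx1 hx2 hx3

/-- The `L¹` norm of the difference of a piecewise constant function and its translate. -/
lemma lintegral_abs_cellFun_sub_le (hfin : ∀ σ ∈ D.edges, μHE[d - 1] σ ≠ ⊤)
    (h : EuclideanSpace ℝ (Fin d)) :
    ∫⁻ x, ENNReal.ofReal |D.cellFun f (x + h) - D.cellFun f x| ≤ ENNReal.ofReal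
      (‖h‖ * ∑ K ∈ D.cells, ∑ σ ∈ D.edgesOf K, (μHE[d - 1] σ).toReal * D.jump f K σ) := by
  let J : Set (EuclideanSpace ℝ (Fin d)) → ℝ := fun σ => ∑ K ∈ D.cellsOf σ, D.jump f K σ
  have hJ : ∀ σ, 0 ≤ J σ := fun σ => Finset.sum_nonneg fun K _ => D.jump_nonneg f
  let A : Set (EuclideanSpace ℝ (Fin d)) → Set (EuclideanSpace ℝ (Fin d)) := fun σ =>
    {x | ∃ s ∈ Set.Icc (0 : ℝ) 1, x + s • h ∈ σ}
  calc ∫⁻ x, ENNReal.ofReal |D.cellFun f (x + h) - D.cellFun f x|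
      ≤ ∫⁻ x, ∑ σ ∈ D.edges,
          -- Measurable hulls of the same volume allow the sum and the integral to be exchanged
          -- without checking that the swept sets are measurable.
          (toMeasurable volume (A σ)).indicator (fun _ => ENNReal.ofReal (J σ)) x := by
        refine lintegral_mono_ae ?_
        filter_upwards [D.ae_abs_cellFun_sub_le_sum f h] with x hx
        refine (ENNReal.ofReal_le_ofReal hx).trans ?_
        rw [ENNReal.ofReal_sum_of_nonneg
          (fun σ _ => Set.indicator_nonneg (fun _ _ => hJ σ) x)]
        refine Finset.sum_le_sum fun σ _ => ?_
        by_cases hxA : x ∈ A σ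
        · rw [Set.indicator_of_mem hxA, Set.indicator_of_mem (subset_toMeasurable _ _ hxA)]
        · rw [Set.indicator_of_notMem hxA, ENNReal.ofReal_zero]
          exact zero_le
    _ = ∑ σ ∈ D.edges, ENNReal.ofReal (J σ) * volume (A σ) := by
        rw [lintegral_finsetSum _ fun σ _ =>
          measurable_const.indicator (measurableSet_toMeasurable _ _)]
        refine Finset.sum_congr rfl fun σ _ => ?_
        rw [lintegral_indicator_const (measurableSet_toMeasurable _ _), measure_toMeasurable]
    _ ≤ ∑ σ ∈ D.edges, ENNReal.ofReal (‖h‖ * ((μHE[d - 1] σ).toReal * J σ)) := by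
        refine Finset.sum_le_sum fun σ hσ => ?_
        have hle := volume_sweep_le (D.norm_normal hσ) (D.measurableSet_edge hσ)
          (fun x hx => D.inner_eq_level hσ hx) (measurableSet_Icc (a := (0 : ℝ)) (b := 1)) h
        rw [Real.volume_Icc, sub_zero, ENNReal.ofReal_one, one_mul,
          ← ENNReal.ofReal_toReal (hfin σ hσ), ← ENNReal.ofReal_mul (norm_nonneg _)] at hle
        refine (mul_le_mul_right hle _).trans (le_of_eq ?_)
        rw [← ENNReal.ofReal_mul (hJ σ)]
        congr 1; ring
    _ = ENNReal.ofReal (∑ σ ∈ D.edges, ‖h‖ * ((μHE[d - 1] σ).toReal * J σ)) := by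
        rw [ENNReal.ofReal_sum_of_nonneg]
        intro σ _
        exact mul_nonneg (norm_nonneg _) (mul_nonneg ENNReal.toReal_nonneg (hJ σ))
    _ = _ := by
        rw [← Finset.mul_sum, ← D.sum_edges_cellsOf fun K σ => (μHE[d - 1] σ).toReal * D.jump f K σ]
        simp only [J, Finset.mul_sum]

/-! ### Cones inside a cell -/

/-- A ray from the cell point meets the edges of `K` in at most one point, since the nearer of two
such points would be interior to `K`. A common point of the cones thus gives a common point of the
disjoint edges. -/
lemma disjoint_coneOver (hK : K ∈ D.cells) (hσ : σ ∈ D.edgesOf K) (hτ : τ ∈ D.edgesOf K)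
    (hne : σ ≠ τ) :
    Disjoint (coneOver (D.normal σ) (D.level σ) (D.center K) σ)
      (coneOver (D.normal τ) (D.level τ) (D.center K) τ) := by
  have key : ∀ {σ τ : Set (EuclideanSpace ℝ (Fin d))} {y y' : EuclideanSpace ℝ (Fin d)} {r r' : ℝ},
      σ ∈ D.edgesOf K → τ ∈ D.edgesOf K → y ∈ σ → y' ∈ τ → 0 < r → 0 < r' → r' < r →
      r • (y - D.center K) ≠ r' • (y' - D.center K) := by
    intro σ τ y y' r r' hσ hτ hy hy' hr hr' hlt he
    have h1 := D.center_add_smul_mem_of_mem_closure hK (D.edge_subset_frontier hK hτ hy').1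
      (r := r' / r) (by positivity) ((div_lt_one hr).2 hlt)
    have h2 : D.center K + (r' / r) • (y' - D.center K) = y := by
      rw [div_eq_inv_mul, mul_smul, ← he, smul_smul, inv_mul_cancel₀ hr.ne', one_smul,
        add_sub_cancel]
    rw [h2] at h1
    exact (D.edge_subset_frontier hK hσ hy).2 h1
  rw [Set.disjoint_left]
  intro z hz hz'
  obtain ⟨y, hy, r, hr, rfl⟩ := exists_of_mem_coneOver hz
  obtain ⟨y', hy', r', hr', he⟩ := exists_of_mem_coneOver hz'
  have he' := add_left_cancel he
  rcases lt_trichotomy r r' with h | h | h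
  · exact key hτ hσ hy' hy hr'.1 hr.1 h he'.symm
  · subst h
    have hyy : y = y' := by
      have := smul_right_injective _ hr.1.ne' he'
      exact sub_left_injective this
    subst hyy
    exact Set.disjoint_left.1 (D.edges_disjoint σ (D.edges_of_mem_edgesOf hK hσ) τ
      (D.edges_of_mem_edgesOf hK hτ) hne) hy hy'
  · exact key hσ hτ hy hy' hr.1 hr'.1 h he'

lemma coneOver_subset_cell (hK : K ∈ D.cells) (hσ : σ ∈ D.edgesOf K) :
    coneOver (D.normal σ) (D.level σ) (D.center K) σ ⊆ K := by
  intro z hz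
  obtain ⟨y, hy, r, hr, rfl⟩ := exists_of_mem_coneOver hz
  exact D.center_add_smul_mem_of_mem_closure hK (D.edge_subset_frontier hK hσ hy).1 hr.1.le hr.2

/-- The cones from the cell point over the edges of `K` are disjoint subsets of `K`. -/
lemma sum_cellDist_mul_le (hd : 1 ≤ d) (hK : K ∈ D.cells) :
    ∑ σ ∈ D.edgesOf K, ENNReal.ofReal (D.cellDist K σ) * μHE[d - 1] σ ≤ 2 ^ d * volume K := by
  calc ∑ σ ∈ D.edgesOf K, ENNReal.ofReal (D.cellDist K σ) * μHE[d - 1] σ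
      ≤ ∑ σ ∈ D.edgesOf K,
          2 ^ d * volume (coneOver (D.normal σ) (D.level σ) (D.center K) σ) := by
        refine Finset.sum_le_sum fun σ hσ => ?_
        have hσ' := D.edges_of_mem_edgesOf hK hσ
        refine le_trans ?_ (mul_le_volume_coneOver hd (D.norm_normal hσ')
          (D.measurableSet_edge hσ') (fun x hx => D.inner_eq_level hσ' hx)
          (D.inner_center_ne_level hK hσ))
        gcongr
        exact D.cellDist_le hK hσ
    _ = 2 ^ d * volume (⋃ σ ∈ D.edgesOf K,
          coneOver (D.normal σ) (D.level σ) (D.center K) σ) := by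
        rw [← Finset.mul_sum, measure_biUnion_finset]
        · exact fun σ hσ τ hτ hne => D.disjoint_coneOver hK hσ hτ hne
        · exact fun σ hσ => measurableSet_coneOver
            (D.measurableSet_edge (D.edges_of_mem_edgesOf hK hσ))
    _ ≤ 2 ^ d * volume K := by
        gcongr
        exact Set.iUnion₂_subset fun σ hσ => D.coneOver_subset_cell hK hσ

lemma volume_cell_ne_top (hΩ : Bornology.IsBounded Ω) (hK : K ∈ D.cells) : volume K ≠ ⊤ :=
  (hΩ.subset (D.cell_subset K hK)).measure_lt_top.ne

/-- The cone over the edge from an adjacent cell point has positive height and lies in a bounded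
cell. -/
lemma edge_measure_ne_top (hd : 1 ≤ d) (hΩ : Bornology.IsBounded Ω) (hσ : σ ∈ D.edges) :
    μHE[d - 1] σ ≠ ⊤ := by
  obtain ⟨K, hK⟩ := D.cellsOf_nonempty hσ
  rw [D.mem_cellsOf] at hK
  intro htop
  have h1 := (Finset.single_le_sum
    (f := fun σ => ENNReal.ofReal (D.cellDist K σ) * μHE[d - 1] σ) (fun _ _ => zero_le) hK.2).trans
    (D.sum_cellDist_mul_le hd hK.1)
  have h2 : ENNReal.ofReal (D.cellDist K σ) ≠ 0 := by
    simpa using D.cellDist_pos hK.1 hK.2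
  rw [htop, ENNReal.mul_top h2, top_le_iff] at h1
  exact ENNReal.mul_ne_top (by simp) (D.volume_cell_ne_top hΩ hK.1) h1

lemma sum_measure_mul_cellDist_le (hd : 1 ≤ d) (hΩ : Bornology.IsBounded Ω) (hK : K ∈ D.cells) :
    ∑ σ ∈ D.edgesOf K, (μHE[d - 1] σ).toReal * D.cellDist K σ ≤ 2 ^ d * (volume K).toReal := by
  have h := ENNReal.toReal_mono (ENNReal.mul_ne_top (by simp) (D.volume_cell_ne_top hΩ hK))
    (D.sum_cellDist_mul_le hd hK)
  rw [ENNReal.toReal_sum, ENNReal.toReal_mul] at h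
  · convert h using 1
    · refine Finset.sum_congr rfl fun σ hσ => ?_
      rw [ENNReal.toReal_mul, ENNReal.toReal_ofReal (D.cellDist_pos hK hσ).le, mul_comm]
    · simp
  · intro σ hσ
    exact ENNReal.mul_ne_top ENNReal.ofReal_ne_top
      (D.edge_measure_ne_top hd hΩ (D.edges_of_mem_edgesOf hK hσ))

end CellFunctions

/-! ### Total variation against the discrete norm -/

lemma edgeDist_pos (hσ : σ ∈ D.edges) : 0 < D.edgeDist σ :=
  Finset.sum_pos (fun _ hK => D.cellDist_pos (D.mem_cellsOf.1 hK).1 (D.mem_cellsOf.1 hK).2)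
    (D.cellsOf_nonempty hσ)

lemma cellsOf_eq (hσ : σ ∈ D.edges) (hK : K ∈ D.cellsOf σ) :
    D.cellsOf σ = {K} ∨ ∃ L, K ≠ L ∧ D.cellsOf σ = {K, L} := by
  classical
  rcases D.card_cellsOf hσ with h | h
  · obtain ⟨M, hM⟩ := Finset.card_eq_one.1 h
    rw [hM, Finset.mem_singleton] at hK
    exact Or.inl (hK ▸ hM)
  · obtain ⟨M, N, hMN, hcells⟩ := Finset.card_eq_two.1 h
    rw [hcells, Finset.mem_insert, Finset.mem_singleton] at hK
    rcases hK with rfl | rfl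
    · exact Or.inr ⟨N, hMN, hcells⟩
    · exact Or.inr ⟨M, hMN.symm, by rw [hcells, Finset.pair_comm]⟩

/-- The only place where the mesh ratio bound enters: it lets the weight `|σ|` be replaced by `|σ|
d_{K,σ} / d_σ`. -/
lemma edgeDist_le {η : ℝ} (hη : 0 < η) (hD : D.RatioBound η) (hσ : σ ∈ D.edges)
    (hK : K ∈ D.cellsOf σ) : D.edgeDist σ ≤ (1 + 1 / η) * D.cellDist K σ := by
  have hpos := D.cellDist_pos (D.mem_cellsOf.1 hK).1 (D.mem_cellsOf.1 hK).2
  rcases D.cellsOf_eq hσ hK with h | ⟨L, hKL, h⟩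
  · rw [edgeDist, h, Finset.sum_singleton]
    have : 0 < 1 / η * D.cellDist K σ := by positivity
    linarith
  · have hL : L ∈ D.cellsOf σ := by rw [h]; simp
    have := (hD σ hσ L hL K hK hKL.symm).2
    rw [div_le_iff₀ hpos] at this
    rw [edgeDist, h, Finset.sum_pair hKL]
    linarith

lemma jump_abs_rpow_le {p : ℝ} (hp : 1 ≤ p) (v : Set (EuclideanSpace ℝ (Fin d)) → ℝ)
    (hσ : σ ∈ D.edges) (hK : K ∈ D.cellsOf σ) :
    D.jump (fun K => |v K| ^ p) K σ ≤
      p * ∑ L ∈ D.cellsOf σ, |v L| ^ (p - 1) * D.jump v L σ := by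
  rcases D.cellsOf_eq hσ hK with h | ⟨L, hKL, h⟩
  · rw [D.jump_of_cellsOf_eq_singleton _ h, h, Finset.sum_singleton,
      D.jump_of_cellsOf_eq_singleton _ h]
    have := rpow_sub_rpow_le hp (abs_nonneg (v K)) le_rfl
    rw [Real.zero_rpow (by linarith), sub_zero, sub_zero] at this
    rw [abs_of_nonneg (by positivity)]
    linarith
  · have h' : D.cellsOf σ = {L, K} := by rw [h, Finset.pair_comm]
    rw [D.jump_of_cellsOf_eq_pair _ hKL h, h, Finset.sum_pair hKL,
      D.jump_of_cellsOf_eq_pair v hKL h, D.jump_of_cellsOf_eq_pair v hKL.symm h',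
      abs_sub_comm (v L)]
    exact abs_rpow_sub_rpow_le hp (v K) (v L)

lemma discreteNorm_nonneg (p : ℝ) (v : Set (EuclideanSpace ℝ (Fin d)) → ℝ) :
    0 ≤ D.discreteNorm p v := by
  refine Real.rpow_nonneg (Finset.sum_nonneg fun K hK => Finset.sum_nonneg fun σ hσ => ?_) _
  exact mul_nonneg (mul_nonneg ENNReal.toReal_nonneg Metric.infDist_nonneg)
    (Real.rpow_nonneg (div_nonneg (D.jump_nonneg v)
      (D.edgeDist_pos (D.edges_of_mem_edgesOf hK hσ)).le) _)

/-- The total variation of the `p`-th power is controlled by the `L^p` norm and the discrete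
`W^{1,p}` norm. -/
lemma sum_jump_abs_rpow_le (hd : 1 ≤ d) (hΩ : Bornology.IsBounded Ω) {p : ℝ} (hp : 1 ≤ p)
    {η : ℝ} (hη : 0 < η) (hD : D.RatioBound η) (v : Set (EuclideanSpace ℝ (Fin d)) → ℝ) :
    ∑ K ∈ D.cells, ∑ σ ∈ D.edgesOf K,
      (μHE[d - 1] σ).toReal * D.jump (fun K => |v K| ^ p) K σ ≤
      2 * p * (1 + 1 / η) * (2 ^ d : ℝ) ^ (1 - 1 / p) *
        (∑ K ∈ D.cells, (volume K).toReal * |v K| ^ p) ^ (1 - 1 / p) * D.discreteNorm p v := by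
  have hp0 : 0 < p := by linarith
  have hp1 : 0 ≤ 1 - 1 / p := by rw [sub_nonneg, div_le_one hp0]; exact hp
  let G : Set (EuclideanSpace ℝ (Fin d)) → Set (EuclideanSpace ℝ (Fin d)) → ℝ :=
    fun L σ => |v L| ^ (p - 1) * D.jump v L σ
  have hG : ∀ L σ, 0 ≤ G L σ := fun L σ => mul_nonneg (by positivity) (D.jump_nonneg v)
  calc ∑ K ∈ D.cells, ∑ σ ∈ D.edgesOf K,
      (μHE[d - 1] σ).toReal * D.jump (fun K => |v K| ^ p) K σ
      = ∑ σ ∈ D.edges, ∑ K ∈ D.cellsOf σ,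
          (μHE[d - 1] σ).toReal * D.jump (fun K => |v K| ^ p) K σ :=
        (D.sum_edges_cellsOf _).symm
    _ ≤ ∑ σ ∈ D.edges, ∑ K ∈ D.cellsOf σ,
          -- The bound for the jump of `|v|^p` is the same from each side of `σ`, and there are at
          -- most two sides; hence the factor `2`.
          2 * p * ((μHE[d - 1] σ).toReal * G K σ) := by
        refine Finset.sum_le_sum fun σ hσ => ?_
        have hcard : ((D.cellsOf σ).card : ℝ) ≤ 2 := by
          rcases D.card_cellsOf hσ with h | h <;> rw [h] <;> norm_num
        calc ∑ K ∈ D.cellsOf σ, (μHE[d - 1] σ).toReal * D.jump (fun K => |v K| ^ p) K σ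
            ≤ ∑ K ∈ D.cellsOf σ, (μHE[d - 1] σ).toReal * (p * ∑ L ∈ D.cellsOf σ, G L σ) :=
              Finset.sum_le_sum fun K hK => mul_le_mul_of_nonneg_left
                (D.jump_abs_rpow_le hp v hσ hK) ENNReal.toReal_nonneg
          _ = (D.cellsOf σ).card * ((μHE[d - 1] σ).toReal * (p * ∑ L ∈ D.cellsOf σ, G L σ)) := by
              rw [Finset.sum_const, nsmul_eq_mul]
          _ ≤ 2 * ((μHE[d - 1] σ).toReal * (p * ∑ L ∈ D.cellsOf σ, G L σ)) := by
              refine mul_le_mul_of_nonneg_right hcard (mul_nonneg ENNReal.toReal_nonneg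
                (mul_nonneg hp0.le (Finset.sum_nonneg fun L _ => hG L σ)))
          _ = _ := by
              simp only [Finset.mul_sum]
              refine Finset.sum_congr rfl fun L _ => ?_
              ring
    _ = ∑ K ∈ D.cells, ∑ σ ∈ D.edgesOf K, 2 * p * ((μHE[d - 1] σ).toReal * G K σ) :=
        D.sum_edges_cellsOf fun K σ => 2 * p * ((μHE[d - 1] σ).toReal * G K σ)
    _ ≤ ∑ K ∈ D.cells, ∑ σ ∈ D.edgesOf K, 2 * p * (1 + 1 / η) *
          ((μHE[d - 1] σ).toReal * D.cellDist K σ * |v K| ^ (p - 1) *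
            (D.jump v K σ / D.edgeDist σ)) := by
        refine Finset.sum_le_sum fun K hK => Finset.sum_le_sum fun σ hσ => ?_
        have hσ' := D.edges_of_mem_edgesOf hK hσ
        have he := D.edgeDist_pos hσ'
        have hle := D.edgeDist_le hη hD hσ' (D.mem_cellsOf.2 ⟨hK, hσ⟩)
        have hj := hG K σ
        have h1 : 1 ≤ (1 + 1 / η) * D.cellDist K σ / D.edgeDist σ := by rwa [one_le_div he]
        have h2 : 0 ≤ 2 * p * ((μHE[d - 1] σ).toReal * G K σ) := by
          have : 0 ≤ (μHE[d - 1] σ).toReal := ENNReal.toReal_nonneg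
          positivity
        calc 2 * p * ((μHE[d - 1] σ).toReal * G K σ)
            ≤ 2 * p * ((μHE[d - 1] σ).toReal * G K σ) *
                ((1 + 1 / η) * D.cellDist K σ / D.edgeDist σ) := le_mul_of_one_le_right h2 h1
          _ = _ := by simp only [G]; ring
    _ = 2 * p * (1 + 1 / η) * ∑ i ∈ D.cells.sigma D.edgesOf,
          (μHE[d - 1] i.2).toReal * D.cellDist i.1 i.2 * |v i.1| ^ (p - 1) *
            (D.jump v i.1 i.2 / D.edgeDist i.2) := by
        simp only [Finset.sum_sigma, Finset.mul_sum]
    _ ≤ 2 * p * (1 + 1 / η) * ((∑ i ∈ D.cells.sigma D.edgesOf,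
          (μHE[d - 1] i.2).toReal * D.cellDist i.1 i.2 * |v i.1| ^ p) ^ (1 - 1 / p) *
          (∑ i ∈ D.cells.sigma D.edgesOf, (μHE[d - 1] i.2).toReal * D.cellDist i.1 i.2 *
            (D.jump v i.1 i.2 / D.edgeDist i.2) ^ p) ^ (1 / p)) := by
        -- Hölder over pairs (cell, edge) with weights `|σ| d_{K,σ}`: one factor is the discrete
        -- norm, the other reduces to the `L^p` norm by the cone estimate.
        refine mul_le_mul_of_nonneg_left (sum_weight_rpow_mul_le (D.cells.sigma D.edgesOf) hp
          (m := fun i => (μHE[d - 1] i.2).toReal * D.cellDist i.1 i.2)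
          (a := fun i => |v i.1|) (b := fun i => D.jump v i.1 i.2 / D.edgeDist i.2)
          ?_ ?_ ?_) (by positivity)
        · exact fun i _ => mul_nonneg ENNReal.toReal_nonneg Metric.infDist_nonneg
        · exact fun i _ => abs_nonneg _
        · intro i hi
          rw [Finset.mem_sigma] at hi
          exact div_nonneg (D.jump_nonneg v)
            (D.edgeDist_pos (D.edges_of_mem_edgesOf hi.1 hi.2)).le
    _ ≤ 2 * p * (1 + 1 / η) * (((2 ^ d : ℝ) *
          ∑ K ∈ D.cells, (volume K).toReal * |v K| ^ p) ^ (1 - 1 / p) * D.discreteNorm p v) := by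
        have e : (∑ i ∈ D.cells.sigma D.edgesOf, (μHE[d - 1] i.2).toReal * D.cellDist i.1 i.2 *
            (D.jump v i.1 i.2 / D.edgeDist i.2) ^ p) ^ (1 / p) = D.discreteNorm p v := by
          rw [discreteNorm, Finset.sum_sigma]
        rw [e]
        refine mul_le_mul_of_nonneg_left (mul_le_mul_of_nonneg_right
          (Real.rpow_le_rpow ?_ ?_ hp1) (D.discreteNorm_nonneg p v)) (by positivity)
        · exact Finset.sum_nonneg fun i _ => mul_nonneg
            (mul_nonneg ENNReal.toReal_nonneg Metric.infDist_nonneg) (by positivity)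
        · rw [Finset.sum_sigma, Finset.mul_sum]
          refine Finset.sum_le_sum fun K hK => ?_
          dsimp only
          rw [← Finset.sum_mul, ← mul_assoc]
          exact mul_le_mul_of_nonneg_right (D.sum_measure_mul_cellDist_le hd hΩ hK) (by positivity)
    _ = _ := by
        rw [Real.mul_rpow (by positivity) (Finset.sum_nonneg fun K _ =>
          mul_nonneg ENNReal.toReal_nonneg (by positivity))]
        ring

lemma lintegral_cellFun (hΩ : Bornology.IsBounded Ω) {f : Set (EuclideanSpace ℝ (Fin d)) → ℝ}
    (hf : ∀ K, 0 ≤ f K) :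
    ∫⁻ x, ENNReal.ofReal (D.cellFun f x) =
      ENNReal.ofReal (∑ K ∈ D.cells, (volume K).toReal * f K) := by
  have e : ∀ x, ENNReal.ofReal (D.cellFun f x) =
      ∑ K ∈ D.cells, K.indicator (fun _ => ENNReal.ofReal (f K)) x := by
    intro x
    rw [cellFun, ENNReal.ofReal_sum_of_nonneg
      fun K _ => Set.indicator_nonneg (fun _ _ => hf K) x]
    refine Finset.sum_congr rfl fun K _ => ?_
    by_cases hx : x ∈ K
    · simp [Set.indicator_of_mem hx]
    · simp [Set.indicator_of_notMem hx]
  simp only [e]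
  rw [lintegral_finsetSum _ fun K hK =>
    measurable_const.indicator (D.cell_isOpen K hK).measurableSet,
    ENNReal.ofReal_sum_of_nonneg fun K _ => mul_nonneg ENNReal.toReal_nonneg (hf K)]
  refine Finset.sum_congr rfl fun K hK => ?_
  rw [lintegral_indicator_const (D.cell_isOpen K hK).measurableSet,
    ENNReal.ofReal_mul ENNReal.toReal_nonneg, ENNReal.ofReal_toReal (D.volume_cell_ne_top hΩ hK),
    mul_comm]

lemma cellFun_comp (f : Set (EuclideanSpace ℝ (Fin d)) → ℝ) {φ : ℝ → ℝ} (hφ : φ 0 = 0)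
    (x : EuclideanSpace ℝ (Fin d)) :
    D.cellFun (fun K => φ (f K)) x = φ (D.cellFun f x) := by
  by_cases h : ∃ K ∈ D.cells, x ∈ K
  · obtain ⟨K, hK, hxK⟩ := h
    rw [D.cellFun_of_mem _ hK hxK, D.cellFun_of_mem _ hK hxK]
  · push Not at h
    rw [D.cellFun_of_forall_notMem _ h, D.cellFun_of_forall_notMem _ h, hφ]

/-- The cells fill `Ω` up to their boundaries, which lie in finitely many hyperplanes and are null.
-/
lemma ae_eq_cellFun (hΩ : IsOpen Ω) {u : EuclideanSpace ℝ (Fin d) → ℝ}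
    {v : Set (EuclideanSpace ℝ (Fin d)) → ℝ} (hu : D.HasCellValues u v) :
    u =ᵐ[volume.restrict Ω] D.cellFun v := by
  rw [EventuallyEq, ae_restrict_iff' hΩ.measurableSet]
  have h1 : ∀ᵐ x : EuclideanSpace ℝ (Fin d), ∀ σ ∈ D.edges,
      inner ℝ (D.normal σ) x ≠ D.level σ := by
    rw [eventually_all_finset]
    intro σ hσ
    simpa using D.ae_inner_ne_level hσ 0
  have h2 : ∀ᵐ x, ∀ K ∈ D.cells, x ∈ K → u x = v K := by
    rw [eventually_all_finset]
    exact fun K hK => (ae_restrict_iff' (D.cell_isOpen K hK).measurableSet).1 (hu K hK)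
  filter_upwards [h1, h2] with x hx1 hx2 hx
  have hcl : x ∈ closure Ω := subset_closure hx
  rw [D.closure_eq] at hcl
  simp only [Set.mem_iUnion, exists_prop] at hcl
  obtain ⟨K, hK, hxK⟩ := hcl
  have hxK' : x ∈ K := by
    by_contra hn
    have : x ∈ closure K \ K := ⟨hxK, hn⟩
    rw [D.cell_boundary K hK] at this
    simp only [Set.mem_iUnion, exists_prop] at this
    obtain ⟨σ, hσ, hxσ⟩ := this
    have hσ' := D.edges_of_mem_edgesOf hK hσ
    exact hx1 σ hσ' (D.inner_eq_level_of_mem_closure hσ' hxσ)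
  rw [hx2 K hK hxK', D.cellFun_of_mem v hK hxK']

end SpaceDiscretisation

/-! ### The discrete Sobolev inequality -/

theorem lemma5p3 (d : ℕ) (hd : 1 ≤ d) (p : ℝ) (hp : 1 ≤ p) :
    ∃ q : ℝ, p < q ∧
      ∀ Ω : Set (EuclideanSpace ℝ (Fin d)), IsPolyhedralDomain Ω →
      ∀ η : ℝ, 0 < η →
      ∃ C : ℝ, 0 < C ∧
        ∀ D : SpaceDiscretisation Ω, D.RatioBound η →
        ∀ (u : EuclideanSpace ℝ (Fin d) → ℝ) (v : Set (EuclideanSpace ℝ (Fin d)) → ℝ),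
          D.HasCellValues u v →
          eLpNorm u (ENNReal.ofReal q) (volume.restrict Ω) ≤
            ENNReal.ofReal (C * D.discreteNorm p v) := by
  have hd0 : (0 : ℝ) < d := by exact_mod_cast hd
  have hp0 : 0 < p := by linarith
  set r : ℝ := 1 + 1 / (2 * d) with hr
  have hr1 : 1 < r := by rw [hr]; simp [hd0]
  have hr0 : 0 < r := by linarith
  have hq0 : 0 < p * r := by positivity
  refine ⟨p * r, by nlinarith, ?_⟩
  intro Ω hΩ η hη
  obtain ⟨R, hR, hΩR⟩ := hΩ.isBounded.exists_pos_norm_lt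
  obtain ⟨C₀, hC₀, hgain⟩ := exists_lintegral_rpow_le_of_translation_estimate hd hR
  set M : ℝ := 2 * p * (1 + 1 / η) * (2 ^ d : ℝ) ^ (1 - 1 / p) with hM
  have hM0 : 0 < M := by positivity
  set A : ℝ := 2 * R * M with hA
  have hA0 : 0 < A := by positivity
  refine ⟨(C₀ * (M * A ^ (p - 1)) ^ r) ^ (1 / (p * r)), by positivity, ?_⟩
  intro D hD u v hu
  set f : Set (EuclideanSpace ℝ (Fin d)) → ℝ := fun K => |v K| ^ p with hf
  have hf0 : ∀ K, 0 ≤ f K := fun K => by simp only [hf]; positivity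
  set T : ℝ := ∑ K ∈ D.cells, ∑ σ ∈ D.edgesOf K, (μHE[d - 1] σ).toReal * D.jump f K σ with hT
  have hT0 : 0 ≤ T := Finset.sum_nonneg fun K _ => Finset.sum_nonneg fun σ _ =>
    mul_nonneg ENNReal.toReal_nonneg (D.jump_nonneg f)
  set X : ℝ := ∑ K ∈ D.cells, (volume K).toReal * f K with hX
  have hX0 : 0 ≤ X := Finset.sum_nonneg fun K _ => mul_nonneg ENNReal.toReal_nonneg (hf0 K)
  set N : ℝ := D.discreteNorm p v with hN
  have hN0 : 0 ≤ N := D.discreteNorm_nonneg p v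
  have hwf : ∀ x, D.cellFun f x = |D.cellFun v x| ^ p := D.cellFun_comp v
    (φ := fun t => |t| ^ p) (by simp [Real.zero_rpow hp0.ne'])
  have hw0 : ∀ x, 0 ≤ D.cellFun f x := fun x => by rw [hwf]; positivity
  have hsupp : ∀ x, R ≤ ‖x‖ → D.cellFun f x = 0 := fun x hx =>
    D.cellFun_of_forall_notMem f fun K hK hxK =>
      absurd (hΩR x (D.cell_subset K hK hxK)) (not_lt.2 hx)
  have htrans : ∀ h, ∫⁻ x, ENNReal.ofReal |D.cellFun f (x + h) - D.cellFun f x| ≤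
      ENNReal.ofReal (‖h‖ * T) := D.lintegral_abs_cellFun_sub_le f
    fun σ hσ => D.edge_measure_ne_top hd hΩ.isBounded hσ
  have hXT : X ≤ 2 * R * T := by
    have h := lintegral_le_of_translation_estimate hd hR hsupp htrans
    rw [D.lintegral_cellFun hΩ.isBounded hf0] at h
    exact (ENNReal.ofReal_le_ofReal_iff (by positivity)).1 h
  have hTX : T ≤ M * X ^ (1 - 1 / p) * N :=
    D.sum_jump_abs_rpow_le hd hΩ.isBounded hp hη hD v
  -- Combining `X ≤ 2RT` with `T ≤ M X^{1 - 1/p} N` puts a lower power of `X` on the right; as `X`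
  -- is finite, it can be cancelled when `X > 0`.
  have hXN : X ^ (1 / p) ≤ A * N := by
    rcases hX0.eq_or_lt with h0 | hXpos
    · rw [← h0, Real.zero_rpow (by positivity)]; positivity
    · have h1 : X ≤ A * N * X ^ (1 - 1 / p) := by
        calc X ≤ 2 * R * T := hXT
          _ ≤ 2 * R * (M * X ^ (1 - 1 / p) * N) := by gcongr
          _ = _ := by rw [hA]; ring
      have h2 : X = X ^ (1 / p) * X ^ (1 - 1 / p) := by
        rw [← Real.rpow_add hXpos]; simp
      refine le_of_mul_le_mul_right ?_ (Real.rpow_pos_of_pos hXpos (1 - 1 / p))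
      rwa [← h2]
  have hTN : T ≤ M * A ^ (p - 1) * N ^ p := by
    have h1 : X ^ (1 - 1 / p) = (X ^ (1 / p)) ^ (p - 1) := by
      rw [← Real.rpow_mul hX0]; congr 1; field_simp
    have h2 : (X ^ (1 / p)) ^ (p - 1) ≤ (A * N) ^ (p - 1) :=
      Real.rpow_le_rpow (by positivity) hXN (by linarith)
    have h3 : N ^ p = N ^ (p - 1) * N := by
      rw [← Real.rpow_add_one' hN0 (by rw [sub_add_cancel]; exact hp0.ne'), sub_add_cancel]
    calc T ≤ M * X ^ (1 - 1 / p) * N := hTX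
      _ ≤ M * (A * N) ^ (p - 1) * N := by rw [h1]; gcongr
      _ = _ := by rw [Real.mul_rpow hA0.le hN0, h3]; ring
  have hfinal := hgain (D.cellFun f) T (D.measurable_cellFun f) hw0 hsupp hT0 htrans
  calc eLpNorm u (ENNReal.ofReal (p * r)) (volume.restrict Ω)
      = eLpNorm (D.cellFun v) (ENNReal.ofReal (p * r)) (volume.restrict Ω) :=
        eLpNorm_congr_ae (D.ae_eq_cellFun hΩ.isOpen hu)
    _ ≤ eLpNorm (D.cellFun v) (ENNReal.ofReal (p * r)) volume :=
        eLpNorm_mono_measure _ Measure.restrict_le_self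
    -- The `L^{pr}` norm of `u` is read off from the `L^r` bound on `|u|^p`; homogeneity in `N` is
    -- restored by the outer power `1/(pr)`.
    _ = (∫⁻ x, ENNReal.ofReal (D.cellFun f x ^ r)) ^ (1 / (p * r)) := by
        rw [eLpNorm_eq_lintegral_rpow_enorm_toReal (by simpa using hq0) ENNReal.ofReal_ne_top,
          ENNReal.toReal_ofReal hq0.le]
        congr 1
        refine lintegral_congr fun x => ?_
        rw [hwf, ← Real.rpow_mul (abs_nonneg _), Real.enorm_eq_ofReal_abs,
          ENNReal.ofReal_rpow_of_nonneg (abs_nonneg _) hq0.le]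
    _ ≤ ENNReal.ofReal (C₀ * (M * A ^ (p - 1) * N ^ p) ^ r) ^ (1 / (p * r)) := by
        gcongr
        exact hfinal.trans (ENNReal.ofReal_le_ofReal (by gcongr))
    _ = _ := by
        rw [ENNReal.ofReal_rpow_of_nonneg (by positivity) (by positivity)]
        congr 1
        rw [Real.mul_rpow (by positivity) (by positivity : (0 : ℝ) ≤ N ^ p), ← mul_assoc,
          Real.mul_rpow (by positivity) (by positivity), ← Real.rpow_mul hN0,
          ← Real.rpow_mul hN0, mul_one_div_cancel hq0.ne', Real.rpow_one]
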